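/- Let $X$ be a complex manifold. A holomorphic line bundle with connection on $X$ is a pair $(L,\nabla)$ of a holomorphic line bundle $L$ (with sheaf of holomorphic sections $\mathcal L$) and a $\mathbb C$-linear map of sheaves $\nabla:\mathcal L\to\Omega^1_X\otimes\mathcal L$ with $\nabla(fs)=df\otimes s+f\,\nabla s$ for local holomorphic functions $f$ and sections $s$. Define $\nabla^2:\Omega^1_X\otimes\mathcal L\to\Omega^2_X\otimes\mathcal L$ by $\nabla^2(\eta\otimes s)=d\eta\otimes s-\eta\wedge\nabla s$. The connection is integrable if $\nabla^2\circ\nabla=0$. A holomorphic $2$-form $R\in H^0(X,\Omega^2_X)$ is the curvature of $(L,\nabla)$ if $\nabla^2(\nabla s)=R\otimes s$ for all local holomorphic sections $s$. Let $\mathrm{Pic}^{an}_c(X)$ be the group of isomorphism classes of holomorphic line bundles with connection; an isomorphism $(L,\nabla)\to(L',\nabla')$ is an isomorphism of holomorphic line bundles compatible with the connections. The group law is the tensor product $(L_1,\nabla_1)\otimes(L_2,\nabla_2)=(L_1\otimes L_2,\nabla)$ with $\nabla(s_1\otimes s_2)=\nabla_1 s_1\otimes s_2+s_1\otimes\nabla_2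 s_2$, and the neutral element is the class of $(\mathcal O_X,d)$. Let $\mathrm{Pic}^{an}_{ci}(X)$ be the group, with the same group law, of isomorphism classes of holomorphic line bundles with integrable connection. Then every holomorphic line bundle with connection has exactly one curvature $R_\nabla\in H^0(X,\Omega^2_X)$, the map $[(L,\nabla)]\mapsto R_\nabla$ is a well-defined homomorphism of groups $\mathrm{Pic}^{an}_c(X)\to H^0(X,\Omega^2_X)$, and together with the map $\mathrm{Pic}^{an}_{ci}(X)\to \mathrm{Pic}^{an}_c(X)$, $[(L,\nabla)]\mapsto[(L,\nabla)]$, it gives an exact sequence of abelian groups $$0\longrightarrow \mathrm{Pic}^{an}_{ci}(X)\longrightarrow \mathrm{Pic}^{an}_{c}(X)\longrightarrow H^0(X,\Omega^2_X).$$ -/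

import Mathlib

open scoped Manifold ContDiff

noncomputable section

namespace HolPic

open Bundle Set Filter
open scoped Topology

universe u v

variable {V : Type u} [NormedAddCommGroup V] [NormedSpace ℂ V]
  {X : Type v} [TopologicalSpace X] [ChartedSpace V X]

/-! ### Holomorphic differential forms -/

variable (V X) in
/-- Differential `p`-forms on `X` (of type `(p, 0)`, no regularity imposed). -/
abbrev Form (p : ℕ) : Type (max u v) :=
  ∀ x : X, TangentSpace 𝓘(ℂ, V) x [⋀^Fin p]→L[ℂ] ℂ

/-- The derivative at `x` of the preferred chart at `i`. -/
def chartD (i x : X) : TangentSpace 𝓘(ℂ, V) x →L[ℂ] V :=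
  mfderiv 𝓘(ℂ, V) 𝓘(ℂ, V) (extChartAt 𝓘(ℂ, V) i) x

/-- The derivative at `z` of the inverse of the preferred chart at `i`. -/
def chartSymmD (i : X) (z : V) :
    V →L[ℂ] TangentSpace 𝓘(ℂ, V) ((extChartAt 𝓘(ℂ, V) i).symm z) :=
  mfderiv 𝓘(ℂ, V) 𝓘(ℂ, V) (extChartAt 𝓘(ℂ, V) i).symm z

/-- The expression of a form in the preferred chart at `i`, that is, its pull-back along the
inverse of this chart. -/
def chartForm {p : ℕ} (η : Form V X p) (i : X) : V → V [⋀^Fin p]→L[ℂ] ℂ := fun z =>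
  (η ((extChartAt 𝓘(ℂ, V) i).symm z)).compContinuousLinearMap (chartSymmD i z)

/-- A form is holomorphic near `x` if its expression in the chart at `x` is. -/
def HolFormAt {p : ℕ} (η : Form V X p) (x : X) : Prop :=
  ContDiffAt ℂ ω (chartForm η x) (extChartAt 𝓘(ℂ, V) x x)

/-- The exterior derivative. -/
def extD {p : ℕ} (η : Form V X p) : Form V X (p + 1) := fun x =>
  (extDeriv (chartForm η x) (extChartAt 𝓘(ℂ, V) x x)).compContinuousLinearMap (chartD x x)

/-- A field of cotangent vectors, regarded as a `1`-form. -/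
def oneForm (α : ∀ x : X, TangentSpace 𝓘(ℂ, V) x →L[ℂ] ℂ) : Form V X 1 := fun x =>
  ContinuousAlternatingMap.ofSubsingleton ℂ (TangentSpace 𝓘(ℂ, V) x) ℂ (0 : Fin 1) (α x)

theorem chartForm_add {p : ℕ} (η θ : Form V X p) (i : X) :
    chartForm (η + θ) i = fun z => chartForm η i z + chartForm θ i z := by
  ext z v; rfl

theorem chartForm_smul {p : ℕ} (c : ℂ) (η : Form V X p) (i : X) :
    chartForm (c • η) i = fun z => c • chartForm η i z := by
  ext z v; rfl

variable (V X) in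
/-- The space `H⁰(X, Ω^p)` of holomorphic `p`-forms on `X`. -/
def HolForm (p : ℕ) : Submodule ℂ (Form V X p) where
  carrier := {η | ∀ x, HolFormAt η x}
  add_mem' {η θ} hη hθ x := by
    have := (hη x).add (hθ x)
    rwa [← chartForm_add] at this
  zero_mem' x := by
    have : chartForm (0 : Form V X p) x = fun _ => 0 := by ext z v; rfl
    unfold HolFormAt
    rw [this]
    exact contDiffAt_const
  smul_mem' c η hη x := by
    have := (hη x).const_smul c
    rwa [← chartForm_smul] at this

variable (V X) in
/-- A holomorphic line bundle on the complex manifold `X` with model space `V`: a topological line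
bundle with an atlas of local trivializations whose transition functions are holomorphic. The
fibres are in the lowest universe; this is no restriction, every line bundle is isomorphic to one
whose fibres are copies of `ℂ`. -/
structure HolLineBundle where
  /-- the fibres -/
  fiber : X → Type
  [addCommGroup : ∀ x, AddCommGroup (fiber x)]
  [module : ∀ x, Module ℂ (fiber x)]
  [fiberTop : ∀ x, TopologicalSpace (fiber x)]
  [fiberTopAdd : ∀ x, IsTopologicalAddGroup (fiber x)]
  [fiberTopSmul : ∀ x, ContinuousSMul ℂ (fiber x)]
  [totalTop : TopologicalSpace (TotalSpace ℂ fiber)]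
  [fiberBundle : FiberBundle ℂ fiber]
  [vectorBundle : VectorBundle ℂ ℂ fiber]
  [holomorphic : ContMDiffVectorBundle ω ℂ fiber 𝓘(ℂ, V)]

attribute [instance] HolLineBundle.addCommGroup HolLineBundle.module HolLineBundle.fiberTop
  HolLineBundle.fiberTopAdd HolLineBundle.fiberTopSmul HolLineBundle.totalTop
  HolLineBundle.fiberBundle HolLineBundle.vectorBundle HolLineBundle.holomorphic

namespace HolLineBundle

/-- The section `s` is holomorphic in a neighbourhood of `x`. Local sections are represented by
arbitrary (set-theoretic) extensions to the whole of `X`. -/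
def HolAt (L : HolLineBundle V X) (s : ∀ x, L.fiber x) (x : X) : Prop :=
  ContMDiffAt 𝓘(ℂ, V) (𝓘(ℂ, V).prod 𝓘(ℂ, ℂ)) ω (fun y => TotalSpace.mk' ℂ y (s y)) x

end HolLineBundle

/-! ### coordinates -/

namespace HolLineBundle

variable (L : HolLineBundle V X)

/-- The domain of the preferred trivialization at `i`. -/
def dom (i : X) : Set X := (trivializationAt ℂ L.fiber i).baseSet

/-- The fibre coordinate of the preferred trivialization at `i`. -/
def coord (i x : X) : L.fiber x →L[ℂ] ℂ :=
  (trivializationAt ℂ L.fiber i).continuousLinearMapAt ℂ x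

/-- The local frame given by the preferred trivialization at `i`. -/
def frame (i x : X) : L.fiber x := (trivializationAt ℂ L.fiber i).symmL ℂ x 1

theorem isOpen_dom (i : X) : IsOpen (L.dom i) := (trivializationAt ℂ L.fiber i).open_baseSet

theorem mem_dom (i : X) : i ∈ L.dom i := FiberBundle.mem_baseSet_trivializationAt' i

theorem dom_mem_nhds {i x : X} (hx : x ∈ L.dom i) : L.dom i ∈ 𝓝 x := (L.isOpen_dom i).mem_nhds hx

variable {L}

theorem coord_frame {i x : X} (hx : x ∈ L.dom i) : L.coord i x (L.frame i x) = 1 :=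
  (trivializationAt ℂ L.fiber i).continuousLinearMapAt_symmL hx 1

theorem coord_smul_frame {i x : X} (hx : x ∈ L.dom i) (v : L.fiber x) :
    L.coord i x v • L.frame i x = v := by
  have := (trivializationAt ℂ L.fiber i).symmL_continuousLinearMapAt (R := ℂ) hx v
  conv_rhs => rw [← this]
  rw [coord, frame, ← map_smul, smul_eq_mul, mul_one]

theorem eq_of_coord {i x : X} (hx : x ∈ L.dom i) {v w : L.fiber x}
    (h : L.coord i x v = L.coord i x w) : v = w := by
  rw [← coord_smul_frame hx v, h, coord_smul_frame hx w]

theorem frame_ne_zero {i x : X} (hx : x ∈ L.dom i) : L.frame i x ≠ 0 := by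
  intro h
  have := coord_frame hx
  simp [h] at this

theorem coord_apply {i x : X} (hx : x ∈ L.dom i) (v : L.fiber x) :
    L.coord i x v = (trivializationAt ℂ L.fiber i ⟨x, v⟩).2 := by
  simp only [coord, Trivialization.continuousLinearMapAt_apply]
  exact (Trivialization.linearMapAt_apply _ v).trans (if_pos hx)

theorem holAt_iff {i x : X} (hx : x ∈ L.dom i) {s : ∀ x, L.fiber x} :
    L.HolAt s x ↔ ContMDiffAt 𝓘(ℂ, V) 𝓘(ℂ, ℂ) ω (fun y => L.coord i y (s y)) x := by
  unfold HolAt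
  rw [(trivializationAt ℂ L.fiber i).contMDiffAt_section_iff hx]
  refine Filter.EventuallyEq.contMDiffAt_iff ?_
  filter_upwards [L.dom_mem_nhds hx] with y hy
  rw [coord_apply hy]

/-- (complex) differentiability of a section at a point -/
def DiffAt (L : HolLineBundle V X) (s : ∀ x, L.fiber x) (x : X) : Prop :=
  MDifferentiableAt 𝓘(ℂ, V) (𝓘(ℂ, V).prod 𝓘(ℂ, ℂ)) (fun y => TotalSpace.mk' ℂ y (s y)) x

theorem HolAt.diffAt {s : ∀ x, L.fiber x} {x : X} (h : L.HolAt s x) : L.DiffAt s x :=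
  ContMDiffAt.mdifferentiableAt h (by simp)

theorem diffAt_iff {x : X} {s : ∀ x, L.fiber x} :
    L.DiffAt s x ↔ MDifferentiableAt 𝓘(ℂ, V) 𝓘(ℂ, ℂ) (fun y => L.coord x y (s y)) x := by
  unfold DiffAt
  rw [mdifferentiableAt_section]
  refine Filter.EventuallyEq.mdifferentiableAt_iff ?_
  filter_upwards [L.dom_mem_nhds (L.mem_dom x)] with y hy
  rw [coord_apply hy]

theorem holAt_frame {i x : X} (hx : x ∈ L.dom i) : L.HolAt (L.frame i) x := by
  rw [holAt_iff hx]
  refine (contMDiffAt_const (c := (1 : ℂ))).congr_of_eventuallyEq ?_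
  filter_upwards [L.dom_mem_nhds hx] with y hy
  exact coord_frame hy

theorem HolAt.congr {s t : ∀ x, L.fiber x} {x : X} (h : L.HolAt s x)
    (e : ∀ᶠ y in 𝓝 x, t y = s y) : L.HolAt t x := by
  refine ContMDiffAt.congr_of_eventuallyEq h ?_
  filter_upwards [e] with y hy
  rw [hy]

theorem HolAt.smul {s : ∀ x, L.fiber x} {x : X} (h : L.HolAt s x) {f : X → ℂ}
    (hf : ContMDiffAt 𝓘(ℂ, V) 𝓘(ℂ, ℂ) ω f x) : L.HolAt (fun y => f y • s y) x := by
  rw [holAt_iff (L.mem_dom x)] at h ⊢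
  simp only [map_smul, smul_eq_mul]
  exact ContMDiffAt.mul hf h

/-- The coefficient of a section with respect to a holomorphic local frame. -/
theorem exists_coeff {e s : ∀ x, L.fiber x} {x : X} (he : L.HolAt e x) (he0 : e x ≠ 0)
    (hs : L.HolAt s x) : ∃ f : X → ℂ, ContMDiffAt 𝓘(ℂ, V) 𝓘(ℂ, ℂ) ω f x ∧
      ∀ᶠ y in 𝓝 x, s y = f y • e y := by
  have he' := (holAt_iff (L.mem_dom x)).1 he
  have hs' := (holAt_iff (L.mem_dom x)).1 hs
  have h0 : L.coord x x (e x) ≠ 0 := fun h =>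
    he0 (eq_of_coord (L.mem_dom x) (by rw [h, map_zero]))
  refine ⟨fun y => L.coord x y (s y) / L.coord x y (e y), hs'.div₀ he' h0, ?_⟩
  filter_upwards [L.dom_mem_nhds (L.mem_dom x), he'.continuousAt.eventually_ne h0] with y hy hy0
  refine eq_of_coord hy ?_
  rw [map_smul, smul_eq_mul, div_mul_cancel₀ _ hy0]

end HolLineBundle

variable [IsManifold 𝓘(ℂ, V) ω X]

variable (V X) in
/-- A holomorphic line bundle with a holomorphic connection `∇`. The covariant derivative assigns
to a section `s` and a point `x` a linear map `∇ s x` from the tangent space at `x` to the fibre at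
`x`; at points where the sections are complex differentiable it is additive and satisfies the
Leibniz rule `∇ (f s) = df ⊗ s + f ∇ s` (hence it is local and `ℂ`-linear), and it sends
holomorphic sections over an open set `U` to holomorphic sections over `U` of `Ω¹ ⊗ L`. -/
structure ConnLineBundle extends HolLineBundle V X where
  /-- the connection `∇` -/
  conn : CovariantDerivative 𝓘(ℂ, V) ℂ fiber
  /-- `∇` maps holomorphic sections over open sets to holomorphic sections -/
  hol_conn : ∀ U : Set X, IsOpen U → ContMDiffCovariantDerivativeOn ℂ ω conn U

namespace ConnLineBundle

/-- The value at the tangent vectors `v`, `w` of `∇² (η ⊗ t) = dη ⊗ t - η ∧ ∇ t`, where `η` is a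
`1`-form and `t` a section. -/
def nablaTwo (A : ConnLineBundle V X) (η : ∀ x : X, TangentSpace 𝓘(ℂ, V) x →L[ℂ] ℂ)
    (t : ∀ x, A.fiber x) (x : X) (v w : TangentSpace 𝓘(ℂ, V) x) : A.fiber x :=
  extD (oneForm η) x ![v, w] • t x - (η x v • A.conn t x w - η x w • A.conn t x v)

/-- `R` is the curvature of the connection: `∇² (∇ s) = R ⊗ s` for all local holomorphic sections
`s`. As the bundle has rank one, `∇ s` is locally of the form `η ⊗ t`, where `η` is a holomorphic
`1`-form and `t` a holomorphic section; the equation is required for all such `η` and `t`. -/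
def IsCurvature (A : ConnLineBundle V X) (R : Form V X 2) : Prop :=
  ∀ (x : X) (s t : ∀ x, A.fiber x) (η : ∀ x : X, TangentSpace 𝓘(ℂ, V) x →L[ℂ] ℂ),
    A.HolAt s x → A.HolAt t x → HolFormAt (oneForm η) x →
    (∀ᶠ y in 𝓝 x, A.conn s y = (η y).smulRight (t y)) →
    ∀ v w, A.nablaTwo η t x v w = R x ![v, w] • s x

/-- An isomorphism of line bundles with connection: a family of linear isomorphisms of the fibres
that identifies the local holomorphic sections and is compatible with the connections. -/
structure Iso (A B : ConnLineBundle V X) where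
  toEquiv : ∀ x, A.fiber x ≃ₗ[ℂ] B.fiber x
  hol_iff : ∀ (s : ∀ x, A.fiber x) (x : X),
    B.HolAt (fun y => toEquiv y (s y)) x ↔ A.HolAt s x
  conn_apply : ∀ (s : ∀ x, A.fiber x) (x : X), A.HolAt s x →
    ∀ v, B.conn (fun y => toEquiv y (s y)) x v = toEquiv x (A.conn s x v)

end ConnLineBundle

theorem oneForm_chart (β : ∀ x : X, TangentSpace 𝓘(ℂ, V) x →L[ℂ] ℂ) (i : X) (z : V) :
    chartForm (oneForm β) i z = ContinuousAlternatingMap.ofSubsingletonLIE (𝕜 := ℂ) (E := V) (F := ℂ) (0 : Fin 1)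
      ((β ((extChartAt 𝓘(ℂ, V) i).symm z)).comp (chartSymmD i z)) := by
  ext v; rfl

theorem holFormAt_oneForm (β : ∀ x : X, TangentSpace 𝓘(ℂ, V) x →L[ℂ] ℂ) (x : X) :
    HolFormAt (oneForm β) x ↔ ContDiffAt ℂ ω (fun z =>
      (β ((extChartAt 𝓘(ℂ, V) x).symm z)).comp (chartSymmD x z)) (extChartAt 𝓘(ℂ, V) x x) := by
  unfold HolFormAt
  rw [funext (oneForm_chart β x)]
  exact ContinuousLinearEquiv.comp_contDiffAt_iff
    (ContinuousAlternatingMap.ofSubsingletonLIE (𝕜 := ℂ) (E := V) (F := ℂ) (0 : Fin 1)).toContinuousLinearEquiv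

theorem holFormAt_oneForm' (β : ∀ x : X, TangentSpace 𝓘(ℂ, V) x →L[ℂ] ℂ) (x : X) :
    HolFormAt (oneForm β) x ↔ ContMDiffAt 𝓘(ℂ, V) 𝓘(ℂ, V →L[ℂ] ℂ) ω (fun y =>
      (β y).comp ((trivializationAt V (TangentSpace 𝓘(ℂ, V)) x).symmL ℂ y)) x := by
  rw [holFormAt_oneForm, contMDiffAt_iff_source]
  rw [← contMDiffAt_iff_contDiffAt]
  simp only [modelWithCornersSelf_coe, range_id, contMDiffWithinAt_univ]
  refine Filter.EventuallyEq.contMDiffAt_iff ?_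
  filter_upwards [(isOpen_extChartAt_target x).mem_nhds (mem_extChartAt_target x)] with z hz
  have hy := (extChartAt 𝓘(ℂ, V) x).map_target hz
  have := TangentBundle.symmL_trivializationAt (I := 𝓘(ℂ, V)) (x₀ := x)
    (x := (extChartAt 𝓘(ℂ, V) x).symm z) (by rwa [extChartAt_source] at hy)
  simp only [Function.comp]
  rw [this]
  have key : ∀ z' : V, z' = z →
      (mfderivWithin 𝓘(ℂ, V) 𝓘(ℂ, V) (extChartAt 𝓘(ℂ, V) x).symm (range 𝓘(ℂ, V)) z' : V →L[ℂ] V)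
        = (mfderiv 𝓘(ℂ, V) 𝓘(ℂ, V) (extChartAt 𝓘(ℂ, V) x).symm z : V →L[ℂ] V) := by
    rintro _ rfl
    rw [modelWithCornersSelf_coe, range_id, mfderivWithin_univ]
  have key' := key _ ((extChartAt 𝓘(ℂ, V) x).right_inv hz)
  refine ContinuousLinearMap.ext fun v => ?_
  exact congrArg (fun T : V →L[ℂ] V => β ((extChartAt 𝓘(ℂ, V) x).symm z) (T v)) key'.symm

theorem hom_iff (L : HolLineBundle V X) {s : ∀ x, L.fiber x} {x : X} (hs : L.HolAt s x)
    (hs0 : s x ≠ 0) (β : ∀ x : X, TangentSpace 𝓘(ℂ, V) x →L[ℂ] ℂ) :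
    ContMDiffAt 𝓘(ℂ, V) (𝓘(ℂ, V).prod 𝓘(ℂ, V →L[ℂ] ℂ)) ω
      (fun y => TotalSpace.mk' (V →L[ℂ] ℂ) (E := fun y => TangentSpace 𝓘(ℂ, V) y →L[ℂ] L.fiber y)
        y ((β y).smulRight (s y))) x ↔ HolFormAt (oneForm β) x := by
  rw [contMDiffAt_hom_bundle, holFormAt_oneForm']
  have hid : ContMDiffAt 𝓘(ℂ, V) 𝓘(ℂ, V) ω (fun y : X => y) x := contMDiffAt_id
  simp only [hid, true_and]
  have h : (fun y => ContinuousLinearMap.inCoordinates V (TangentSpace 𝓘(ℂ, V)) ℂ L.fiber x y x y ((β y).smulRight (s y))) = fun y => L.coord x y (s y) • (β y).comp ((trivializationAt V (TangentSpace 𝓘(ℂ, V)) x).symmL ℂ y) := by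
    ext y v
    simp [ContinuousLinearMap.inCoordinates, HolLineBundle.coord, mul_comm]
  rw [h]
  have hc := (HolLineBundle.holAt_iff (L.mem_dom x)).1 hs
  have h0 : L.coord x x (s x) ≠ 0 := fun h =>
    hs0 (HolLineBundle.eq_of_coord (L.mem_dom x) (by rw [h, map_zero]))
  refine ⟨fun H => ?_, fun H => ContMDiffAt.smul hc H⟩
  refine (ContMDiffAt.smul (hc.inv₀ h0) H).congr_of_eventuallyEq ?_
  filter_upwards [hc.continuousAt.eventually_ne h0] with y hy
  simp [smul_smul, inv_mul_cancel₀ hy]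

/-- The differential of a holomorphic function is a holomorphic `1`-form. -/
theorem holFormAt_d {f : X → ℂ} {x : X} (hf : ContMDiffAt 𝓘(ℂ, V) 𝓘(ℂ, ℂ) ω f x) :
    HolFormAt (oneForm (mvfderiv 𝓘(ℂ, V) f)) x := by
  rw [holFormAt_oneForm']
  have := ContMDiffAt.mfderiv_const hf (m := ω) (by simp)
  refine this.congr_of_eventuallyEq ?_
  filter_upwards with y
  refine ContinuousLinearMap.ext fun v => ?_
  simp [inTangentCoordinates, ContinuousLinearMap.inCoordinates, mvfderiv]
  rfl

namespace ConnLineBundle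

variable {A B : ConnLineBundle V X}

theorem conn_congr {s t : ∀ x, A.fiber x} {x : X} (hs : A.DiffAt s x)
    (h : ∀ᶠ y in 𝓝 x, t y = s y) : A.conn t x = A.conn s x := by
  have ht : A.DiffAt t x := by
    refine MDifferentiableAt.congr_of_eventuallyEq hs ?_
    filter_upwards [h] with y hy
    rw [hy]
  exact (A.conn.isCovariantDerivativeOn (s := univ)).congr_of_eventuallyEq ht hs univ_mem h

theorem conn_smul {s e : ∀ x, A.fiber x} {f : X → ℂ} {x : X} (he : A.DiffAt e x)
    (hf : MDifferentiableAt 𝓘(ℂ, V) 𝓘(ℂ, ℂ) f x) (h : ∀ᶠ y in 𝓝 x, s y = f y • e y) :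
    A.conn s x = f x • A.conn e x + (mvfderiv 𝓘(ℂ, V) f x).smulRight (e x) := by
  have hd : A.DiffAt (f • e) x := MDifferentiableAt.smul_section hf he
  rw [conn_congr hd h]
  exact (A.conn.isCovariantDerivativeOn (s := univ)).leibniz he hf

theorem hol_conn_at {s : ∀ x, A.fiber x} {x : X} (hs : A.HolAt s x) :
    ContMDiffAt 𝓘(ℂ, V) (𝓘(ℂ, V).prod 𝓘(ℂ, V →L[ℂ] ℂ)) ω
      (fun y => TotalSpace.mk' (V →L[ℂ] ℂ) (E := fun y => TangentSpace 𝓘(ℂ, V) y →L[ℂ] A.fiber y)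
        y (A.conn s y)) x := by
  have : ∀ᶠ y in 𝓝 x, A.HolAt s y := by
    have h := (contMDiffAt_iff_contMDiffAt_nhds (by simp)).1
      ((HolLineBundle.holAt_iff (A.mem_dom x)).1 hs)
    filter_upwards [h, A.dom_mem_nhds (A.mem_dom x)] with y hy hyd
    exact (HolLineBundle.holAt_iff hyd).2 hy
  obtain ⟨U, hU, hUo, hxU⟩ := eventually_nhds_iff.1 this
  have := (A.hol_conn U hUo).contMDiff (σ := s) fun y hy => (hU y hy).contMDiffWithinAt
  exact (this x hxU).contMDiffAt (hUo.mem_nhds hxU)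

/-- The connection form of `A` in the preferred trivialization at `i`. -/
def connForm (A : ConnLineBundle V X) (i x : X) : TangentSpace 𝓘(ℂ, V) x →L[ℂ] ℂ :=
  (A.coord i x).comp (A.conn (A.frame i) x)

theorem conn_frame {i x : X} (hx : x ∈ A.dom i) :
    A.conn (A.frame i) x = (A.connForm i x).smulRight (A.frame i x) := by
  ext v
  simp [connForm, HolLineBundle.coord_smul_frame hx]

theorem hol_connForm {i x : X} (hx : x ∈ A.dom i) : HolFormAt (oneForm (A.connForm i)) x := by
  rw [← hom_iff A.toHolLineBundle (HolLineBundle.holAt_frame hx) (HolLineBundle.frame_ne_zero hx)]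
  refine (hol_conn_at (HolLineBundle.holAt_frame hx)).congr_of_eventuallyEq ?_
  filter_upwards [A.dom_mem_nhds hx] with y hy
  rw [conn_frame hy]

end ConnLineBundle

theorem mvfderiv_congr {f g : X → ℂ} {x : X} (h : f =ᶠ[𝓝 x] g) :
    mvfderiv 𝓘(ℂ, V) f x = mvfderiv 𝓘(ℂ, V) g x := by
  refine ContinuousLinearMap.ext fun v => ?_
  have := h.mfderiv_eq (I := 𝓘(ℂ, V)) (I' := 𝓘(ℂ, ℂ))
  exact congrArg (fun T : V →L[ℂ] ℂ => T v) this

theorem HolFormAt.add_smul {α β : ∀ x : X, TangentSpace 𝓘(ℂ, V) x →L[ℂ] ℂ} {f : X → ℂ} {x : X}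
    (hα : HolFormAt (oneForm α) x) (hβ : HolFormAt (oneForm β) x)
    (hf : ContMDiffAt 𝓘(ℂ, V) 𝓘(ℂ, ℂ) ω f x) :
    HolFormAt (oneForm fun y => α y + f y • β y) x := by
  rw [holFormAt_oneForm'] at *
  exact hα.add (hf.smul hβ)

namespace HolLineBundle

variable (L : HolLineBundle V X)

/-- The transition function `g i j`, determined by `frame i = g i j • frame j`. -/
def trans (i j x : X) : ℂ := L.coord j x (L.frame i x)

variable {L}

theorem trans_smul {i j x : X} (hj : x ∈ L.dom j) :
    L.trans i j x • L.frame j x = L.frame i x := coord_smul_frame hj _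

theorem coord_eq {i j x : X} (hi : x ∈ L.dom i) (v : L.fiber x) :
    L.coord j x v = L.coord i x v * L.trans i j x := by
  conv_lhs => rw [← coord_smul_frame hi v]
  rw [map_smul, smul_eq_mul, trans]

theorem trans_hol {i j x : X} (hi : x ∈ L.dom i) (hj : x ∈ L.dom j) :
    ContMDiffAt 𝓘(ℂ, V) 𝓘(ℂ, ℂ) ω (L.trans i j) x :=
  (holAt_iff hj).1 (holAt_frame hi)

theorem diffAt_iff' {i x : X} (hi : x ∈ L.dom i) {s : ∀ x, L.fiber x} :
    L.DiffAt s x ↔ MDifferentiableAt 𝓘(ℂ, V) 𝓘(ℂ, ℂ) (fun y => L.coord i y (s y)) x := by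
  rw [diffAt_iff]
  have h1 : (fun y => L.coord x y (s y)) =ᶠ[𝓝 x] fun y => L.coord i y (s y) * L.trans i x y := by
    filter_upwards [L.dom_mem_nhds hi] with y hy using coord_eq hy _
  have h2 : (fun y => L.coord i y (s y)) =ᶠ[𝓝 x] fun y => L.coord x y (s y) * L.trans x i y := by
    filter_upwards [L.dom_mem_nhds (L.mem_dom x)] with y hy using coord_eq hy _
  constructor <;> intro h
  · exact (MDifferentiableAt.mul h
      ((trans_hol (L.mem_dom x) hi).mdifferentiableAt (by simp))).congr_of_eventuallyEq h2
  · exact (MDifferentiableAt.mul h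
      ((trans_hol hi (L.mem_dom x)).mdifferentiableAt (by simp))).congr_of_eventuallyEq h1

theorem withConn_aux {α : X → ∀ x : X, TangentSpace 𝓘(ℂ, V) x →L[ℂ] ℂ}
    (compat : ∀ i j x, x ∈ L.dom i → x ∈ L.dom j →
      mvfderiv 𝓘(ℂ, V) (L.trans i j) x = L.trans i j x • (α i x - α j x))
    {i x : X} (hx : x ∈ L.dom i) {s : ∀ x, L.fiber x} (hs : L.DiffAt s x) :
    (mvfderiv 𝓘(ℂ, V) (fun y => L.coord x y (s y)) x + L.coord x x (s x) • α x x).smulRight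
      (L.frame x x) =
    (mvfderiv 𝓘(ℂ, V) (fun y => L.coord i y (s y)) x + L.coord i x (s x) • α i x).smulRight
      (L.frame i x) := by
  have h1 : (fun y => L.coord x y (s y)) =ᶠ[𝓝 x]
      (fun y => L.coord i y (s y)) * (L.trans i x) := by
    filter_upwards [L.dom_mem_nhds hx] with y hy using coord_eq hy _
  rw [mvfderiv_congr h1, mvfderiv_mul ((diffAt_iff' hx).1 hs)
    ((trans_hol hx (L.mem_dom x)).mdifferentiableAt (by simp)), compat i x x hx (L.mem_dom x),
    ← trans_smul (i := i) (L.mem_dom x), coord_eq (j := x) hx (s x)]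
  ext v
  simp only [ContinuousLinearMap.smulRight_apply, _root_.add_apply,
    _root_.smul_apply, _root_.sub_apply, smul_eq_mul, smul_smul]
  congr 1
  ring

/-- The connection on a line bundle which is given by the forms `α i` with respect to the
preferred local frames: `∇ (f • frame i) = df ⊗ frame i + f α i ⊗ frame i`. -/
def withConn (L : HolLineBundle V X) (α : X → ∀ x : X, TangentSpace 𝓘(ℂ, V) x →L[ℂ] ℂ)
    (hol : ∀ i, ∀ x ∈ L.dom i, HolFormAt (oneForm (α i)) x)
    (compat : ∀ i j x, x ∈ L.dom i → x ∈ L.dom j →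
      mvfderiv 𝓘(ℂ, V) (L.trans i j) x = L.trans i j x • (α i x - α j x)) :
    ConnLineBundle V X where
  toHolLineBundle := L
  conn :=
    { toFun := fun s x => (mvfderiv 𝓘(ℂ, V) (fun y => L.coord x y (s y)) x +
        L.coord x x (s x) • α x x).smulRight (L.frame x x)
      isCovariantDerivativeOnUniv :=
        { add := by
            intro s t x hs ht _
            have h : (fun y => L.coord x y ((s + t) y)) =
              (fun y => L.coord x y (s y)) + fun y => L.coord x y (t y) := by
              ext y; simp
            rw [h, mvfderiv_add (diffAt_iff.1 hs) (diffAt_iff.1 ht)]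
            ext v
            simp only [Pi.add_apply, map_add, ContinuousLinearMap.smulRight_apply,
              _root_.add_apply, _root_.smul_apply, smul_eq_mul]
            module
          leibniz := by
            intro s f x hs hf _
            have h : (fun y => L.coord x y ((f • s) y)) = f * fun y => L.coord x y (s y) := by
              ext y; simp
            have e : (mvfderiv 𝓘(ℂ, V) f x).smulRight (s x) =
                (mvfderiv 𝓘(ℂ, V) f x).smulRight (L.coord x x (s x) • L.frame x x) := by
              rw [coord_smul_frame (L.mem_dom x)]
            rw [h, mvfderiv_mul hf (diffAt_iff.1 hs), e]
            ext v
            simp only [Pi.smul_apply', map_smul, ContinuousLinearMap.smulRight_apply,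
              _root_.add_apply, _root_.smul_apply, smul_eq_mul]
            module } }
  hol_conn U hU := by
    constructor
    intro s hs x hx
    have hsx : ∀ y ∈ U, L.HolAt s y := fun y hy => (hs y hy).contMDiffAt (hU.mem_nhds hy)
    refine ContMDiffAt.contMDiffWithinAt ?_
    have hf := (holAt_iff (L.mem_dom x)).1 (hsx x hx)
    refine ((hom_iff L (holAt_frame (L.mem_dom x)) (frame_ne_zero (L.mem_dom x)) _).2
      ((holFormAt_d hf).add_smul (hol x x (L.mem_dom x)) hf)).congr_of_eventuallyEq ?_
    filter_upwards [L.dom_mem_nhds (L.mem_dom x), hU.mem_nhds hx] with y hy hyU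
    exact congrArg _ (withConn_aux compat hy (hsx y hyU).diffAt)

/-- Data for gluing a line bundle: an open cover with a preferred member around each point,
and transition functions. -/
structure Transition (V : Type u) [NormedAddCommGroup V] [NormedSpace ℂ V] (X : Type v)
    [TopologicalSpace X] [ChartedSpace V X] where
  U : X → Set X
  isOpen_U : ∀ i, IsOpen (U i)
  mem_U : ∀ i, i ∈ U i
  g : X → X → X → ℂ
  g_self : ∀ i, ∀ x ∈ U i, g i i x = 1
  g_comp : ∀ i j k x, x ∈ U i → x ∈ U j → x ∈ U k → g i j x * g j k x = g i k x
  g_hol : ∀ i j x, x ∈ U i → x ∈ U j → ContMDiffAt 𝓘(ℂ, V) 𝓘(ℂ, ℂ) ω (g i j) x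

namespace Transition

variable (T : Transition V X)

/-- The vector bundle core given by the transition functions. -/
def core : VectorBundleCore ℂ X ℂ X where
  baseSet := T.U
  isOpen_baseSet := T.isOpen_U
  indexAt := id
  mem_baseSet_at := T.mem_U
  coordChange i j x := T.g i j x • ContinuousLinearMap.id ℂ ℂ
  coordChange_self i x hx v := by simp [T.g_self i x hx]
  continuousOn_coordChange i j x hx :=
    ((T.g_hol i j x hx.1 hx.2).continuousAt.smul continuousAt_const).continuousWithinAt
  coordChange_comp i j k x hx v := by
    simp [← T.g_comp i j k x hx.1.1 hx.1.2 hx.2]; ring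

instance : T.core.IsContMDiff 𝓘(ℂ, V) ω where
  contMDiffOn_coordChange i j x hx :=
    ((T.g_hol i j x hx.1 hx.2).smul contMDiffAt_const).contMDiffWithinAt

instance (x : X) : IsTopologicalAddGroup (T.core.Fiber x) :=
  inferInstanceAs (IsTopologicalAddGroup ℂ)

instance (x : X) : ContinuousSMul ℂ (T.core.Fiber x) :=
  inferInstanceAs (ContinuousSMul ℂ ℂ)

/-- The line bundle glued from the transition functions. -/
def bundle : HolLineBundle V X where
  fiber := T.core.Fiber

theorem dom_bundle (i : X) : T.bundle.dom i = T.U i := rfl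

theorem trans_bundle {i j x : X} (hi : x ∈ T.U i) (hj : x ∈ T.U j) :
    T.bundle.trans i j x = T.g i j x := by
  have hx := T.mem_U x
  have h1 := T.core.trivializationAt_continuousLinearMapAt (b₀ := j) (b := x) hj
  have h2 := T.core.trivializationAt_symmL (b₀ := i) (b := x) hi
  have h3 : T.bundle.trans i j x =
      (trivializationAt ℂ T.core.Fiber j).continuousLinearMapAt ℂ x
        ((trivializationAt ℂ T.core.Fiber i).symmL ℂ x 1) := rfl
  rw [h3, h1, h2]
  change T.g x j x • (T.g i x x • (1 : ℂ)) = T.g i j x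
  rw [← T.g_comp i x j x hi hx hj]
  simp [mul_comm]

end Transition

theorem trans_ne_zero {i j x : X} (hi : x ∈ L.dom i) (hj : x ∈ L.dom j) : L.trans i j x ≠ 0 := by
  intro h
  apply frame_ne_zero hi
  rw [← trans_smul hj, h, zero_smul]

/-- The tensor product of two line bundles, glued from the products of the transition functions. -/
def tensor (L M : HolLineBundle V X) : HolLineBundle V X := Transition.bundle
  { U := fun i => L.dom i ∩ M.dom i
    isOpen_U := fun i => (L.isOpen_dom i).inter (M.isOpen_dom i)
    mem_U := fun i => ⟨L.mem_dom i, M.mem_dom i⟩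
    g := fun i j x => L.trans i j x * M.trans i j x
    g_self := fun i x hx => by
      rw [trans, trans, coord_frame hx.1, coord_frame hx.2, mul_one]
    g_comp := fun i j k x _ hj _ => by
      rw [show L.trans i k x = _ from coord_eq hj.1 (L.frame i x),
        show M.trans i k x = _ from coord_eq hj.2 (M.frame i x), ← trans, ← trans]
      ring
    g_hol := fun i j x hi hj => (trans_hol hi.1 hj.1).mul (trans_hol hi.2 hj.2) }

/-- The dual line bundle, glued from the inverse transition functions. -/
def dual (L : HolLineBundle V X) : HolLineBundle V X := Transition.bundle
  { U := L.dom
    isOpen_U := L.isOpen_dom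
    mem_U := L.mem_dom
    g := fun i j x => (L.trans i j x)⁻¹
    g_self := fun i x hx => by rw [trans, coord_frame hx, inv_one]
    g_comp := fun i j k x _ hj _ => by
      rw [show L.trans i k x = _ from coord_eq hj (L.frame i x), ← trans, mul_inv]
    g_hol := fun i j x hi hj => (trans_hol hi hj).inv₀ (trans_ne_zero hi hj) }

theorem mem_tensor {L M : HolLineBundle V X} {i x : X} :
    x ∈ (L.tensor M).dom i ↔ x ∈ L.dom i ∧ x ∈ M.dom i := Iff.rfl

theorem mem_dual {i x : X} : x ∈ L.dual.dom i ↔ x ∈ L.dom i := Iff.rfl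

theorem trans_tensor {L M : HolLineBundle V X} {i j x : X} (hi : x ∈ (L.tensor M).dom i)
    (hj : x ∈ (L.tensor M).dom j) : (L.tensor M).trans i j x = L.trans i j x * M.trans i j x :=
  Transition.trans_bundle _ hi hj

theorem trans_dual {i j x : X} (hi : x ∈ L.dual.dom i) (hj : x ∈ L.dual.dom j) :
    L.dual.trans i j x = (L.trans i j x)⁻¹ :=
  Transition.trans_bundle _ hi hj

/-- The canonical bilinear map from the fibres of two line bundles to the fibre of the tensor
product. -/
def tmul (L M : HolLineBundle V X) (x : X) (v : L.fiber x) (w : M.fiber x) :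
    (L.tensor M).fiber x :=
  (L.coord x x v * M.coord x x w) • (L.tensor M).frame x x

theorem tmul_eq {L M : HolLineBundle V X} {i x : X} (hi : x ∈ (L.tensor M).dom i)
    (v : L.fiber x) (w : M.fiber x) :
    tmul L M x v w = (L.coord i x v * M.coord i x w) • (L.tensor M).frame i x := by
  obtain ⟨h1, h2⟩ := mem_tensor.1 hi
  rw [tmul, coord_eq (j := x) h1 v, coord_eq (j := x) h2 w,
    ← trans_smul (L := L.tensor M) (i := i) ((L.tensor M).mem_dom x),
    trans_tensor hi ((L.tensor M).mem_dom x), smul_smul]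
  congr 1
  ring

/-- The inverse in the fibre of the dual bundle of a nonzero vector. -/
def vinv (L : HolLineBundle V X) (x : X) (v : L.fiber x) : L.dual.fiber x :=
  (L.coord x x v)⁻¹ • L.dual.frame x x

theorem vinv_eq {i x : X} (hi : x ∈ L.dom i) (v : L.fiber x) :
    vinv L x v = (L.coord i x v)⁻¹ • L.dual.frame i x := by
  rw [vinv, coord_eq (j := x) hi v,
    ← trans_smul (L := L.dual) (i := i) (L.dual.mem_dom x),
    trans_dual hi (L.dual.mem_dom x), smul_smul, mul_inv]

end HolLineBundle

namespace ConnLineBundle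

open HolLineBundle

variable {A B : ConnLineBundle V X}

theorem connForm_compat {i j x : X} (hi : x ∈ A.dom i) (hj : x ∈ A.dom j) :
    mvfderiv 𝓘(ℂ, V) (A.trans i j) x = A.trans i j x • (A.connForm i x - A.connForm j x) := by
  have h := conn_smul (A := A) (s := A.frame i) (holAt_frame hj).diffAt
    ((trans_hol hi hj).mdifferentiableAt (by simp)) (by
      filter_upwards [A.dom_mem_nhds hj] with y hy using (trans_smul hy).symm)
  rw [conn_frame hi, conn_frame hj, ← trans_smul (i := i) hj] at h
  ext v
  have hv := congrArg (fun T => A.coord j x (T v)) h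
  simp only [ContinuousLinearMap.smulRight_apply, _root_.add_apply, _root_.smul_apply,
    map_smul, map_add, coord_frame hj, smul_eq_mul, mul_one] at hv
  simp only [_root_.sub_apply, _root_.smul_apply, smul_eq_mul]
  linear_combination -hv

/-- The tensor product of two line bundles with connection. Its connection form is the sum of the
connection forms, that is, `∇ (s ⊗ t) = ∇ s ⊗ t + s ⊗ ∇ t`; this is proved in `conn_tmul` below. -/
def tensor (A B : ConnLineBundle V X) : ConnLineBundle V X :=
  (A.toHolLineBundle.tensor B.toHolLineBundle).withConn (fun i x => A.connForm i x + B.connForm i x)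
    (fun i x hx => by
      obtain ⟨h1, h2⟩ := mem_tensor.1 hx
      simpa using (hol_connForm h1).add_smul (hol_connForm h2) (contMDiffAt_const (c := (1 : ℂ))))
    (fun i j x hi hj => by
      obtain ⟨i1, i2⟩ := mem_tensor.1 hi
      obtain ⟨j1, j2⟩ := mem_tensor.1 hj
      have h : (A.toHolLineBundle.tensor B.toHolLineBundle).trans i j =ᶠ[𝓝 x]
          A.trans i j * B.trans i j := by
        filter_upwards [HolLineBundle.dom_mem_nhds _ hi, HolLineBundle.dom_mem_nhds _ hj]
          with y h1 h2 using trans_tensor h1 h2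
      rw [mvfderiv_congr h, trans_tensor hi hj, mvfderiv_mul
        ((trans_hol i1 j1).mdifferentiableAt (by simp))
        ((trans_hol i2 j2).mdifferentiableAt (by simp)),
        connForm_compat i1 j1, connForm_compat i2 j2]
      module)

/-- The dual of a line bundle with connection, with the dual connection. Its connection form is
the negative of the connection form. -/
def dual (A : ConnLineBundle V X) : ConnLineBundle V X :=
  A.toHolLineBundle.dual.withConn (fun i x => - A.connForm i x)
    (fun i x hx => by
      have h := hol_connForm (A := A) (mem_dual.1 hx)
      rw [holFormAt_oneForm'] at h ⊢
      exact h.neg)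
    (fun i j x hi hj => by
      have h : (A.trans i j) * A.toHolLineBundle.dual.trans i j =ᶠ[𝓝 x] fun _ => 1 := by
        filter_upwards [HolLineBundle.dom_mem_nhds _ hi, HolLineBundle.dom_mem_nhds _ hj]
          with y h1 h2
        simp only [Pi.mul_apply]
        rw [trans_dual h1 h2, mul_inv_cancel₀ (trans_ne_zero (mem_dual.1 h1) (mem_dual.1 h2))]
      have h' := mvfderiv_congr (V := V) h
      rw [mvfderiv_const, mvfderiv_mul
        ((trans_hol (mem_dual.1 hi) (mem_dual.1 hj)).mdifferentiableAt (by simp))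
        ((trans_hol hi hj).mdifferentiableAt (by simp)),
        connForm_compat (mem_dual.1 hi) (mem_dual.1 hj),
        trans_dual hi hj] at h'
      have h0 := trans_ne_zero (L := A.toHolLineBundle) (mem_dual.1 hi) (mem_dual.1 hj)
      rw [trans_dual hi hj]
      ext v
      have hv := congrArg (fun T => T v) h'
      simp only [_root_.add_apply, _root_.smul_apply, _root_.sub_apply, _root_.neg_apply,
        _root_.zero_apply, smul_eq_mul] at hv ⊢
      refine mul_left_cancel₀ h0 ?_
      rw [inv_mul_cancel_left₀ h0] at hv
      rw [mul_inv_cancel_left₀ h0]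
      linear_combination hv)

end ConnLineBundle

theorem coord_trivial (i x : X) (v : Bundle.Trivial X ℂ x) :
    (trivializationAt ℂ (Bundle.Trivial X ℂ) i).continuousLinearMapAt ℂ x v = v := by
  change (Bundle.Trivial.trivialization X ℂ).continuousLinearMapAt ℂ x v = v
  rw [Bundle.Trivial.continuousLinearMapAt_trivialization]
  rfl

variable (V X) in
/-- The trivial line bundle `𝒪`. -/
def HolLineBundle.trivial : HolLineBundle V X where
  fiber := Bundle.Trivial X ℂ
  fiberTopAdd _ := inferInstanceAs (IsTopologicalAddGroup ℂ)
  fiberTopSmul _ := inferInstanceAs (ContinuousSMul ℂ ℂ)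

theorem HolLineBundle.trivial_holAt {f : X → ℂ} {x : X} :
    (HolLineBundle.trivial V X).HolAt f x ↔ ContMDiffAt 𝓘(ℂ, V) 𝓘(ℂ, ℂ) ω f x := by
  refine (HolLineBundle.holAt_iff ((HolLineBundle.trivial V X).mem_dom x)).trans ?_
  refine Filter.EventuallyEq.contMDiffAt_iff (Filter.Eventually.of_forall fun y => ?_)
  exact coord_trivial x y (f y)

theorem HolLineBundle.trivial_diffAt {f : X → ℂ} {x : X} :
    (HolLineBundle.trivial V X).DiffAt f x ↔ MDifferentiableAt 𝓘(ℂ, V) 𝓘(ℂ, ℂ) f x := by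
  refine HolLineBundle.diffAt_iff.trans ?_
  refine Filter.EventuallyEq.mdifferentiableAt_iff (Filter.Eventually.of_forall fun y => ?_)
  exact coord_trivial x y (f y)

namespace ConnLineBundle

open HolLineBundle

variable {A B C : ConnLineBundle V X}

variable (V X) in
/-- The trivial line bundle with the connection `d`. -/
def trivial : ConnLineBundle V X where
  toHolLineBundle := HolLineBundle.trivial V X
  conn :=
    { toFun := fun (f : X → ℂ) => mvfderiv 𝓘(ℂ, V) f
      isCovariantDerivativeOnUniv :=
        { add := fun {f h x} hf hh _ =>
            mvfderiv_add (trivial_diffAt.1 hf) (trivial_diffAt.1 hh)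
          leibniz := fun {f h x} hf hh _ =>
            mvfderiv_smul hh (trivial_diffAt.1 hf) } }
  hol_conn U hU := by
    constructor
    intro f hf x hx
    have hfx : ContMDiffAt 𝓘(ℂ, V) 𝓘(ℂ, ℂ) ω f x :=
      trivial_holAt.1 ((hf x hx).contMDiffAt (hU.mem_nhds hx))
    refine ContMDiffAt.contMDiffWithinAt ?_
    refine ((hom_iff (HolLineBundle.trivial V X) (s := fun _ => (1 : ℂ))
      (trivial_holAt.2 contMDiffAt_const)
      (one_ne_zero (α := ℂ)) _).2 (holFormAt_d hfx)).congr_of_eventuallyEq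
        (Filter.Eventually.of_forall fun y => ?_)
    refine congrArg _ (ContinuousLinearMap.ext fun v => ?_)
    exact (mul_one (mvfderiv 𝓘(ℂ, V) f y v)).symm

theorem holAt_map {φ : ∀ x, A.fiber x ≃ₗ[ℂ] B.fiber x} {e s : ∀ x, A.fiber x}
    {f : ∀ x, B.fiber x} {x : X} (he : A.HolAt e x) (he0 : e x ≠ 0) (hf : B.HolAt f x)
    (h : ∀ᶠ y in 𝓝 x, φ y (e y) = f y) (hs : A.HolAt s x) :
    B.HolAt (fun y => φ y (s y)) x := by
  obtain ⟨k, hk, hks⟩ := exists_coeff he he0 hs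
  refine (hf.smul hk).congr ?_
  filter_upwards [h, hks] with y h1 h2
  rw [h2, map_smul, h1]

theorem conn_map {φ : ∀ x, A.fiber x ≃ₗ[ℂ] B.fiber x} {e s : ∀ x, A.fiber x}
    {f : ∀ x, B.fiber x} {x : X} (he : A.HolAt e x) (he0 : e x ≠ 0) (hf : B.HolAt f x)
    (h : ∀ᶠ y in 𝓝 x, φ y (e y) = f y) (hs : A.HolAt s x)
    {α : TangentSpace 𝓘(ℂ, V) x →L[ℂ] ℂ} (hA : A.conn e x = α.smulRight (e x))
    (hB : B.conn f x = α.smulRight (f x)) (v : TangentSpace 𝓘(ℂ, V) x) :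
    B.conn (fun y => φ y (s y)) x v = φ x (A.conn s x v) := by
  obtain ⟨k, hk, hks⟩ := exists_coeff he he0 hs
  have hk' := hk.mdifferentiableAt (by simp)
  rw [conn_smul he.diffAt hk' hks, conn_smul (A := B) (e := f) (f := k) hf.diffAt hk' (by
    filter_upwards [h, hks] with y h1 h2
    rw [h2, map_smul, h1]), hA, hB]
  simp [h.self_of_nhds]

/-- `A` has local frames `e i` on the members of the open cover `U`, with
transition functions `g` and connection forms `α`. -/
structure Rep (A : ConnLineBundle V X) (U : X → Set X) (g : X → X → X → ℂ)
    (α : X → ∀ x : X, TangentSpace 𝓘(ℂ, V) x →L[ℂ] ℂ) : Prop where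
  isOpen : ∀ i, IsOpen (U i)
  mem : ∀ i, i ∈ U i
  ex : ∃ e : X → ∀ x, A.fiber x, ∀ i, ∀ x ∈ U i, A.HolAt (e i) x ∧ e i x ≠ 0 ∧
    A.conn (e i) x = (α i x).smulRight (e i x) ∧ ∀ j, x ∈ U j → e i x = g i j x • e j x

theorem rep_self (A : ConnLineBundle V X) : A.Rep A.dom A.trans A.connForm where
  isOpen := A.isOpen_dom
  mem := A.mem_dom
  ex := ⟨A.frame, fun _ _ hx => ⟨holAt_frame hx, frame_ne_zero hx, conn_frame hx,
    fun _ hj => (trans_smul hj).symm⟩⟩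

/-- The linear identification of the fibre at `x` with `ℂ` -/
def coordEquiv (A : ConnLineBundle V X) (x : X) : A.fiber x ≃ₗ[ℂ] ℂ where
  toFun := A.coord x x
  map_add' := map_add _
  map_smul' := map_smul _
  invFun c := c • A.frame x x
  left_inv v := coord_smul_frame (A.mem_dom x) v
  right_inv c := by simp [coord_frame (A.mem_dom x)]

theorem exists_equiv {x : X} {v : A.fiber x} {w : B.fiber x} (hv : v ≠ 0) (hw : w ≠ 0) :
    ∃ φ : A.fiber x ≃ₗ[ℂ] B.fiber x, φ v = w := by
  have h1 : A.coordEquiv x v ≠ 0 := by simpa using hv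
  have h2 : B.coordEquiv x w ≠ 0 := by simpa using hw
  refine ⟨(A.coordEquiv x).trans ((LinearEquiv.smulOfNeZero ℂ ℂ _
    (div_ne_zero h2 h1)).trans (B.coordEquiv x).symm), ?_⟩
  rw [LinearEquiv.trans_apply, LinearEquiv.trans_apply, LinearEquiv.symm_apply_eq]
  simp [div_mul_cancel₀ _ h1]

theorem Rep.iso {U U' : X → Set X} {g g' : X → X → X → ℂ}
    {α α' : X → ∀ x : X, TangentSpace 𝓘(ℂ, V) x →L[ℂ] ℂ} (hA : A.Rep U g α) (hB : B.Rep U' g' α')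
    (hg : ∀ i j x, x ∈ U i → x ∈ U' i → x ∈ U j → x ∈ U' j → g i j x = g' i j x)
    (hα : ∀ i x, x ∈ U i → x ∈ U' i → α i x = α' i x) : Nonempty (Iso A B) := by
  obtain ⟨e, he⟩ := hA.ex
  obtain ⟨f, hf⟩ := hB.ex
  choose φ hφ using fun x => exists_equiv (he x x (hA.mem x)).2.1 (hf x x (hB.mem x)).2.1
  have key : ∀ i x, x ∈ U i → x ∈ U' i → φ x (e i x) = f i x := by
    intro i x h1 h2
    rw [(he i x h1).2.2.2 x (hA.mem x), (hf i x h2).2.2.2 x (hB.mem x), map_smul, hφ,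
      hg i x x h1 h2 (hA.mem x) (hB.mem x)]
  have ev : ∀ x, ∀ᶠ y in 𝓝 x, φ y (e x y) = f x y := fun x => by
    filter_upwards [(hA.isOpen x).mem_nhds (hA.mem x), (hB.isOpen x).mem_nhds (hB.mem x)]
      with y h1 h2 using key x y h1 h2
  refine ⟨⟨φ, fun s x => ⟨fun h => ?_, fun h => ?_⟩, fun s x hs v => ?_⟩⟩
  · have := holAt_map (φ := fun y => (φ y).symm) (he := (hf x x (hB.mem x)).1)
      (hf x x (hB.mem x)).2.1 (he x x (hA.mem x)).1 (by
        filter_upwards [ev x] with y hy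
        rw [← hy, LinearEquiv.symm_apply_apply]) h
    simpa using this
  · exact holAt_map (he x x (hA.mem x)).1 (he x x (hA.mem x)).2.1 (hf x x (hB.mem x)).1 (ev x) h
  · exact conn_map (he x x (hA.mem x)).1 (he x x (hA.mem x)).2.1 (hf x x (hB.mem x)).1 (ev x) hs
      (he x x (hA.mem x)).2.2.1
      (by rw [hα x x (hA.mem x) (hB.mem x)]; exact (hf x x (hB.mem x)).2.2.1) v

theorem Rep.map {U : X → Set X} {g : X → X → X → ℂ}
    {α : X → ∀ x : X, TangentSpace 𝓘(ℂ, V) x →L[ℂ] ℂ} (hA : A.Rep U g α) (φ : Iso A B) :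
    B.Rep U g α := by
  obtain ⟨e, he⟩ := hA.ex
  refine ⟨hA.isOpen, hA.mem, fun i x => φ.toEquiv x (e i x), fun i x hx => ?_⟩
  obtain ⟨h1, h2, h3, h4⟩ := he i x hx
  refine ⟨(φ.hol_iff _ _).2 h1, by simpa using h2, ?_, fun j hj => ?_⟩
  · ext v
    rw [φ.conn_apply _ _ h1, h3]
    simp
  · simp only [h4 j hj, map_smul]

theorem rep_trivial : (trivial V X).Rep (fun _ => univ) (fun _ _ _ => 1) (fun _ _ => 0) where
  isOpen _ := isOpen_univ
  mem _ := mem_univ _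
  ex := by
    refine ⟨fun _ _ => (1 : ℂ), fun i x _ => ⟨trivial_holAt.2 contMDiffAt_const,
      one_ne_zero (α := ℂ), ?_, fun j _ => (one_smul ℂ (1 : ℂ)).symm⟩⟩
    have := mvfderiv_const (I := 𝓘(ℂ, V)) (1 : ℂ) (x := x)
    refine Eq.trans this ?_
    ext v
    exact (zero_mul (1 : ℂ)).symm

theorem withConn_frame {L : HolLineBundle V X} {α : X → ∀ x : X, TangentSpace 𝓘(ℂ, V) x →L[ℂ] ℂ}
    (hol) (compat) {i x : X} (hx : x ∈ L.dom i) :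
    (L.withConn α hol compat).conn (L.frame i) x = (α i x).smulRight (L.frame i x) := by
  have h := withConn_aux compat hx (holAt_frame hx).diffAt
  refine h.trans ?_
  have h1 : (fun y => L.coord i y (L.frame i y)) =ᶠ[𝓝 x] fun _ => 1 := by
    filter_upwards [L.dom_mem_nhds hx] with y hy using coord_frame hy
  rw [mvfderiv_congr h1, mvfderiv_const, coord_frame hx]
  simp

theorem conn_tensor_frame {i x : X} (hx : x ∈ (A.tensor B).dom i) :
    (A.tensor B).conn ((A.tensor B).frame i) x =
      (A.connForm i x + B.connForm i x).smulRight ((A.tensor B).frame i x) :=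
  withConn_frame _ _ hx

theorem conn_dual_frame {i x : X} (hx : x ∈ A.dual.dom i) :
    A.dual.conn (A.dual.frame i) x = (- A.connForm i x).smulRight (A.dual.frame i x) :=
  withConn_frame _ _ hx

/-- `s ⊗ t` as a vector of the tensor product -/
def tmul (A B : ConnLineBundle V X) (x : X) (v : A.fiber x) (w : B.fiber x) :
    (A.tensor B).fiber x := HolLineBundle.tmul A.toHolLineBundle B.toHolLineBundle x v w

theorem tmul_def (x : X) (v : A.fiber x) (w : B.fiber x) :
    tmul A B x v w = (A.coord x x v * B.coord x x w) • (A.tensor B).frame x x := rfl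

theorem tmul_smul (x : X) (a b : ℂ) (v : A.fiber x) (w : B.fiber x) :
    tmul A B x (a • v) (b • w) = (a * b) • tmul A B x v w := by
  simp only [tmul_def, map_smul, smul_eq_mul]
  module

theorem tmul_smul_left (x : X) (a : ℂ) (v : A.fiber x) (w : B.fiber x) :
    tmul A B x (a • v) w = a • tmul A B x v w := by
  simp only [tmul_def, map_smul, smul_eq_mul]
  module

theorem tmul_smul_right (x : X) (b : ℂ) (v : A.fiber x) (w : B.fiber x) :
    tmul A B x v (b • w) = b • tmul A B x v w := by
  simp only [tmul_def, map_smul, smul_eq_mul]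
  module

theorem tmul_eq' {i x : X} (hi : x ∈ (A.tensor B).dom i) (v : A.fiber x) (w : B.fiber x) :
    tmul A B x v w = (A.coord i x v * B.coord i x w) • (A.tensor B).frame i x :=
  HolLineBundle.tmul_eq hi v w

/-- The inverse of a nonzero vector, as a vector of the dual bundle -/
def vinv (A : ConnLineBundle V X) (x : X) (v : A.fiber x) : A.dual.fiber x :=
  HolLineBundle.vinv A.toHolLineBundle x v

theorem vinv_def (x : X) (v : A.fiber x) :
    vinv A x v = (A.coord x x v)⁻¹ • A.dual.frame x x := rfl

theorem vinv_eq' {i x : X} (hi : x ∈ A.dom i) (v : A.fiber x) :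
    vinv A x v = (A.coord i x v)⁻¹ • A.dual.frame i x := HolLineBundle.vinv_eq hi v

theorem coord_conn {s : ∀ x, A.fiber x} {i x : X} (hx : x ∈ A.dom i) (hs : A.DiffAt s x)
    (v : TangentSpace 𝓘(ℂ, V) x) : A.coord i x (A.conn s x v) =
      mvfderiv 𝓘(ℂ, V) (fun y => A.coord i y (s y)) x v + A.coord i x (s x) * A.connForm i x v := by
  rw [conn_smul (A := A) (holAt_frame hx).diffAt ((diffAt_iff' hx).1 hs) (by
    filter_upwards [A.dom_mem_nhds hx] with y hy using (coord_smul_frame hy _).symm),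
    conn_frame hx]
  simp [coord_frame hx]
  ring

theorem holAt_tmul {s : ∀ x, A.fiber x} {t : ∀ x, B.fiber x} {x : X} (hs : A.HolAt s x)
    (ht : B.HolAt t x) : (A.tensor B).HolAt (fun y => tmul A B y (s y) (t y)) x := by
  have hx := (A.tensor B).mem_dom x
  refine ((holAt_frame hx).smul (((holAt_iff (A.mem_dom x)).1 hs).mul
    ((holAt_iff (B.mem_dom x)).1 ht))).congr ?_
  filter_upwards [(A.tensor B).dom_mem_nhds hx] with y hy
  exact tmul_eq' hy _ _

/-- `∇ (s ⊗ t) = ∇ s ⊗ t + s ⊗ ∇ t` -/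
theorem conn_tmul {s : ∀ x, A.fiber x} {t : ∀ x, B.fiber x} {x : X} (hs : A.DiffAt s x)
    (ht : B.DiffAt t x) (v : TangentSpace 𝓘(ℂ, V) x) :
    (A.tensor B).conn (fun y => tmul A B y (s y) (t y)) x v =
      tmul A B x (A.conn s x v) (t x) + tmul A B x (s x) (B.conn t x v) := by
  have hx := (A.tensor B).mem_dom x
  have hs' := diffAt_iff.1 hs
  have ht' := diffAt_iff.1 ht
  rw [conn_smul (A := A.tensor B) (e := (A.tensor B).frame x) (holAt_frame hx).diffAt (hs'.mul ht') (by
    filter_upwards [(A.tensor B).dom_mem_nhds hx] with y hy using tmul_eq' hy _ _),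
    conn_tensor_frame hx, mvfderiv_mul hs' ht', tmul_def, tmul_def,
    coord_conn (A.mem_dom x) hs, coord_conn (B.mem_dom x) ht]
  simp only [ContinuousLinearMap.smulRight_apply, _root_.add_apply, _root_.smul_apply,
    smul_eq_mul, Pi.mul_apply]
  module

theorem Rep.tensor {U U' : X → Set X} {g g' : X → X → X → ℂ}
    {α α' : X → ∀ x : X, TangentSpace 𝓘(ℂ, V) x →L[ℂ] ℂ} (hA : A.Rep U g α)
    (hB : B.Rep U' g' α') : (A.tensor B).Rep (fun i => U i ∩ U' i)
      (fun i j x => g i j x * g' i j x) (fun i x => α i x + α' i x) := by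
  obtain ⟨e, he⟩ := hA.ex
  obtain ⟨f, hf⟩ := hB.ex
  refine ⟨fun i => (hA.isOpen i).inter (hB.isOpen i), fun i => ⟨hA.mem i, hB.mem i⟩,
    fun i x => tmul A B x (e i x) (f i x), fun i x hx => ?_⟩
  obtain ⟨h1, h2, h3, h4⟩ := he i x hx.1
  obtain ⟨k1, k2, k3, k4⟩ := hf i x hx.2
  refine ⟨holAt_tmul h1 k1, ?_, ?_, fun j hj => ?_⟩
  · refine smul_ne_zero (mul_ne_zero ?_ ?_) (frame_ne_zero ((A.tensor B).mem_dom x))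
    · exact fun h => h2 (eq_of_coord (A.mem_dom x) (by rw [h, map_zero]))
    · exact fun h => k2 (eq_of_coord (B.mem_dom x) (by rw [h, map_zero]))
  · ext v
    rw [conn_tmul h1.diffAt k1.diffAt, h3, k3]
    simp only [ContinuousLinearMap.smulRight_apply, tmul_smul_left, tmul_smul_right,
      _root_.add_apply]
    module
  · simp only [h4 j hj.1, k4 j hj.2, tmul_smul]

theorem Rep.dual {U : X → Set X} {g : X → X → X → ℂ}
    {α : X → ∀ x : X, TangentSpace 𝓘(ℂ, V) x →L[ℂ] ℂ} (hA : A.Rep U g α) :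
    A.dual.Rep U (fun i j x => (g i j x)⁻¹) (fun i x => - α i x) := by
  obtain ⟨e, he⟩ := hA.ex
  refine ⟨hA.isOpen, hA.mem, fun i x => vinv A x (e i x), fun i x hx => ?_⟩
  obtain ⟨h1, h2, h3, h4⟩ := he i x hx
  have hxd := A.dual.mem_dom x
  have hc : A.coord x x (e i x) ≠ 0 :=
    fun h => h2 (eq_of_coord (A.mem_dom x) (by rw [h, map_zero]))
  have hhol := (holAt_iff (A.mem_dom x)).1 h1
  have hinv := hhol.inv₀ hc
  have hev : ∀ᶠ y in 𝓝 x, vinv A y (e i y) =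
      (A.coord x y (e i y))⁻¹ • A.dual.frame x y := by
    filter_upwards [A.dom_mem_nhds (A.mem_dom x)] with y hy using vinv_eq' hy _
  refine ⟨((holAt_frame hxd).smul hinv).congr hev, smul_ne_zero (inv_ne_zero hc)
    (frame_ne_zero hxd), ?_, fun j hj => ?_⟩
  · have hmul : (fun y => A.coord x y (e i y)) * (fun y => (A.coord x y (e i y))⁻¹) =ᶠ[𝓝 x]
        fun _ => 1 := by
      filter_upwards [hhol.continuousAt.eventually_ne hc] with y hy using mul_inv_cancel₀ hy
    have hd := mvfderiv_congr (V := V) hmul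
    rw [mvfderiv_const, mvfderiv_mul (hhol.mdifferentiableAt (by simp))
      (hinv.mdifferentiableAt (by simp))] at hd
    rw [conn_smul (A := A.dual) (e := A.dual.frame x) (holAt_frame hxd).diffAt (hinv.mdifferentiableAt (by simp)) hev,
      conn_dual_frame hxd]
    ext v
    have hdv := congrArg (fun T => T v) hd
    have hcv := coord_conn (A.mem_dom x) h1.diffAt v
    rw [h3] at hcv
    simp only [ContinuousLinearMap.smulRight_apply, _root_.add_apply, _root_.smul_apply,
      _root_.neg_apply, _root_.zero_apply, smul_eq_mul, map_smul, vinv_def] at hdv hcv ⊢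
    rw [smul_smul, smul_smul, ← add_smul]
    congr 1
    refine mul_left_cancel₀ hc ?_
    linear_combination hdv + (A.coord x x (e i x))⁻¹ * hcv
  · simp only [h4 j hj, vinv_def, map_smul, smul_eq_mul, mul_inv, smul_smul]

end ConnLineBundle

/-- The expression of a cotangent field in the chart at `i`. -/
def chartCov (β : ∀ x : X, TangentSpace 𝓘(ℂ, V) x →L[ℂ] ℂ) (i : X) (z : V) : V →L[ℂ] ℂ :=
  (β ((extChartAt 𝓘(ℂ, V) i).symm z)).comp (chartSymmD i z)

theorem chartD_self (x : X) (v : TangentSpace 𝓘(ℂ, V) x) : chartD x x v = v := by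
  have := mfderiv_extChartAt_self (I := 𝓘(ℂ, V)) (x := x)
  exact congrArg (fun T : V →L[ℂ] V => T v) this

theorem chartCov_self (β : ∀ x : X, TangentSpace 𝓘(ℂ, V) x →L[ℂ] ℂ) (x : X)
    (v : TangentSpace 𝓘(ℂ, V) x) :
    chartCov β x (extChartAt 𝓘(ℂ, V) x x) (chartD x x v) = β x v := by
  have h1 : ∀ y : X, y = x → (β y : V →L[ℂ] ℂ) = (β x : V →L[ℂ] ℂ) := by
    rintro _ rfl; rfl
  have h2 := h1 _ (extChartAt_to_inv (I := 𝓘(ℂ, V)) x)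
  have h3 : (chartSymmD x (extChartAt 𝓘(ℂ, V) x x) : V →L[ℂ] V) (chartD x x v : V) = v := by
    have := mfderivWithin_extChartAt_symm_comp_mfderiv_extChartAt' (I := 𝓘(ℂ, V)) (x := x)
      (mem_extChartAt_source (I := 𝓘(ℂ, V)) x)
    rw [modelWithCornersSelf_coe, range_id, mfderivWithin_univ] at this
    exact congrArg (fun T : V →L[ℂ] V => T v) this
  calc _ = (β ((extChartAt 𝓘(ℂ, V) x).symm (extChartAt 𝓘(ℂ, V) x x)) : V →L[ℂ] ℂ)
        ((chartSymmD x (extChartAt 𝓘(ℂ, V) x x) : V →L[ℂ] V) (chartD x x v : V)) := rfl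
    _ = _ := by rw [h3]; exact congrArg (fun T : V →L[ℂ] ℂ => T v) h2

theorem holFormAt_chartCov {β : ∀ x : X, TangentSpace 𝓘(ℂ, V) x →L[ℂ] ℂ} {x : X}
    (h : HolFormAt (oneForm β) x) :
    DifferentiableAt ℂ (chartCov β x) (extChartAt 𝓘(ℂ, V) x x) :=
  ((holFormAt_oneForm β x).1 h).differentiableAt (by simp)

theorem extD_oneForm {β : ∀ x : X, TangentSpace 𝓘(ℂ, V) x →L[ℂ] ℂ} {x : X}
    (h : HolFormAt (oneForm β) x) (v w : TangentSpace 𝓘(ℂ, V) x) :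
    extD (oneForm β) x ![v, w] =
      fderiv ℂ (chartCov β x) (extChartAt 𝓘(ℂ, V) x x) (chartD x x v) (chartD x x w) -
      fderiv ℂ (chartCov β x) (extChartAt 𝓘(ℂ, V) x x) (chartD x x w) (chartD x x v) := by
  have hd := holFormAt_chartCov h
  have h0 : DifferentiableAt ℂ (chartForm (oneForm β) x) (extChartAt 𝓘(ℂ, V) x x) :=
    ContDiffAt.differentiableAt h (by simp)
  have h1 : extD (oneForm β) x ![v, w] = extDeriv (chartForm (oneForm β) x)
      (extChartAt 𝓘(ℂ, V) x x) ![chartD x x v, chartD x x w] := by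
    unfold extD
    rw [ContinuousAlternatingMap.compContinuousLinearMap_apply]
    congr 1
    ext i; fin_cases i <;> rfl
  have h2 : ∀ u : V, (fun z => chartForm (oneForm β) x z ![u]) = fun z => chartCov β x z u := by
    intro u; ext z; rfl
  have h3 : ∀ u u' : V, fderiv ℂ (fun z => chartCov β x z u) (extChartAt 𝓘(ℂ, V) x x) u' =
      fderiv ℂ (chartCov β x) (extChartAt 𝓘(ℂ, V) x x) u' u := by
    intro u u'
    rw [fderiv_clm_apply hd (differentiableAt_const _)]
    simp
  rw [h1, extDeriv_apply h0]
  have e0 : (0 : Fin 2).removeNth ![chartD x x v, chartD x x w] = ![chartD x x w] := by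
    ext i; fin_cases i; rfl
  have e1 : (1 : Fin 2).removeNth ![chartD x x v, chartD x x w] = ![chartD x x v] := by
    ext i; fin_cases i; rfl
  rw [Fin.sum_univ_two, e0, e1, h2, h2, h3, h3]
  simp [sub_eq_add_neg]

theorem chartCov_d {f : X → ℂ} {x : X} (hf : ContMDiffAt 𝓘(ℂ, V) 𝓘(ℂ, ℂ) ω f x) :
    chartCov (mvfderiv 𝓘(ℂ, V) f) x =ᶠ[𝓝 (extChartAt 𝓘(ℂ, V) x x)]
      fderiv ℂ (f ∘ (extChartAt 𝓘(ℂ, V) x).symm) := by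
  have h1 := (contMDiffAt_iff_contMDiffAt_nhds (by simp)).1 hf
  have h2 := (continuousAt_extChartAt_symm (I := 𝓘(ℂ, V)) x)
  have h3 : ∀ᶠ z in 𝓝 (extChartAt 𝓘(ℂ, V) x x),
      ContMDiffAt 𝓘(ℂ, V) 𝓘(ℂ, ℂ) ω f ((extChartAt 𝓘(ℂ, V) x).symm z) := by
    refine h2.eventually ?_
    rwa [extChartAt_to_inv]
  filter_upwards [h3, (isOpen_extChartAt_target x).mem_nhds (mem_extChartAt_target x)] with z hz hzt
  have h4 : MDifferentiableAt 𝓘(ℂ, V) 𝓘(ℂ, V) (extChartAt 𝓘(ℂ, V) x).symm z := by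
    have := mdifferentiableWithinAt_extChartAt_symm (I := 𝓘(ℂ, V)) hzt
    rwa [modelWithCornersSelf_coe, range_id, mdifferentiableWithinAt_univ] at this
  have h5 := mfderiv_comp z (hz.mdifferentiableAt (by simp)) h4
  rw [mfderiv_eq_fderiv] at h5
  exact h5.symm

namespace ConnLineBundle

open HolLineBundle

variable {A B C : ConnLineBundle V X}

/-- The curvature is the exterior derivative of the connection form of a local frame. -/
theorem nablaTwo_eq {x : X} {e s t : ∀ x, A.fiber x}
    {α η : ∀ x : X, TangentSpace 𝓘(ℂ, V) x →L[ℂ] ℂ} (he : A.HolAt e x) (he0 : e x ≠ 0)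
    (hα : HolFormAt (oneForm α) x) (hconn : ∀ᶠ y in 𝓝 x, A.conn e y = (α y).smulRight (e y))
    (hs : A.HolAt s x) (ht : A.HolAt t x) (hη : HolFormAt (oneForm η) x)
    (h : ∀ᶠ y in 𝓝 x, A.conn s y = (η y).smulRight (t y)) (v w : TangentSpace 𝓘(ℂ, V) x) :
    A.nablaTwo η t x v w = extD (oneForm α) x ![v, w] • s x := by
  obtain ⟨f, hf, hfs⟩ := exists_coeff he he0 hs
  obtain ⟨k, hk, hkt⟩ := exists_coeff he he0 ht
  have hd : ∀ {f : X → ℂ} {s : ∀ x, A.fiber x}, ContMDiffAt 𝓘(ℂ, V) 𝓘(ℂ, ℂ) ω f x →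
      (∀ᶠ y in 𝓝 x, s y = f y • e y) → ∀ᶠ y in 𝓝 x, A.conn s y =
        (f y • α y + mvfderiv 𝓘(ℂ, V) f y).smulRight (e y) := by
    intro f s hf hs
    have hf' := (contMDiffAt_iff_contMDiffAt_nhds (by simp)).1 hf
    have he' := (contMDiffAt_iff_contMDiffAt_nhds (by simp)).1
      ((HolLineBundle.holAt_iff (A.mem_dom x)).1 he)
    filter_upwards [hf', he', A.dom_mem_nhds (A.mem_dom x), hs.eventually_nhds, hconn]
      with y h1 h2 h3 h4 h5
    rw [conn_smul ((HolLineBundle.holAt_iff h3).2 h2).diffAt (h1.mdifferentiableAt (by simp)) h4, h5]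
    ext v
    simp [add_smul, smul_smul]
  have hne : ∀ᶠ y in 𝓝 x, e y ≠ 0 := by
    have h1 := (HolLineBundle.holAt_iff (A.mem_dom x)).1 he
    have h0 : A.coord x x (e x) ≠ 0 := fun h =>
      he0 (eq_of_coord (A.mem_dom x) (by rw [h, map_zero]))
    filter_upwards [h1.continuousAt.eventually_ne h0] with y hy h
    exact hy (by simp [h])
  have hrel : ∀ᶠ y in 𝓝 x, f y • α y + mvfderiv 𝓘(ℂ, V) f y = k y • η y := by
    filter_upwards [hd hf hfs, h, hkt, hne] with y h1 h2 h3 h4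
    ext v
    have := congrArg (fun T => T v) (h1.symm.trans h2)
    simp only [ContinuousLinearMap.smulRight_apply, h3, smul_smul] at this
    have := smul_left_injective ℂ h4 this
    simpa [mul_comm] using this
  -- pass to the chart at `x`
  set z := extChartAt 𝓘(ℂ, V) x x with hz
  set ψ := (extChartAt 𝓘(ℂ, V) x).symm with hψ
  have hψz : ψ z = x := extChartAt_to_inv x
  have hψc : ContinuousAt ψ z := continuousAt_extChartAt_symm x
  have hF : ∀ {f : X → ℂ}, ContMDiffAt 𝓘(ℂ, V) 𝓘(ℂ, ℂ) ω f x → ContDiffAt ℂ ω (f ∘ ψ) z := by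
    intro f hf
    have := contMDiffAt_iff_source.1 hf
    rw [modelWithCornersSelf_coe, range_id, contMDiffWithinAt_univ,
      contMDiffAt_iff_contDiffAt] at this
    exact this
  have hrel' : (fun y => (f ∘ ψ) y • chartCov α x y + fderiv ℂ (f ∘ ψ) y) =ᶠ[𝓝 z]
      fun y => (k ∘ ψ) y • chartCov η x y := by
    have h1 : ∀ᶠ y in 𝓝 z, f (ψ y) • α (ψ y) + mvfderiv 𝓘(ℂ, V) f (ψ y) = k (ψ y) • η (ψ y) := by
      refine hψc.eventually
        (p := fun y => f y • α y + mvfderiv 𝓘(ℂ, V) f y = k y • η y) ?_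
      rwa [hψz]
    filter_upwards [h1, chartCov_d hf] with y hy hy'
    rw [← hy']
    ext u
    exact congrArg (fun T => T (chartSymmD x y u)) hy
  have hF1 := (hF hf).differentiableAt (by simp)
  have hK1 := (hF hk).differentiableAt (by simp)
  have hF2 : DifferentiableAt ℂ (fderiv ℂ (f ∘ ψ)) z :=
    ((hF hf).fderiv_right (m := 1) (by simp)).differentiableAt (by simp)
  have ha := holFormAt_chartCov hα
  have hh := holFormAt_chartCov hη
  have hsymm := ((hF hf).isSymmSndFDerivAt (by simp)).eq (chartD x x v) (chartD x x w)
  have hder := hrel'.fderiv_eq (𝕜 := ℂ)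
  rw [fderiv_fun_add (hF1.fun_smul ha) hF2, fderiv_fun_smul (𝕜 := ℂ) hF1 ha, fderiv_fun_smul (𝕜 := ℂ) hK1 hh] at hder
  have hvw := congrArg (fun T => T (chartD x x v) (chartD x x w)) hder
  have hwv := congrArg (fun T => T (chartD x x w) (chartD x x v)) hder
  have hct := (hd hk hkt).self_of_nhds
  have hr := hrel.self_of_nhds
  have hdk : ∀ u, fderiv ℂ (k ∘ ψ) z (chartD x x u) = mvfderiv 𝓘(ℂ, V) k x u := fun u => by
    rw [← (chartCov_d hk).self_of_nhds, chartCov_self]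
  have hdf : ∀ u, fderiv ℂ (f ∘ ψ) z (chartD x x u) = mvfderiv 𝓘(ℂ, V) f x u := fun u => by
    rw [← (chartCov_d hf).self_of_nhds, chartCov_self]
  have hca : ∀ u, chartCov α x z (chartD x x u) = α x u := chartCov_self α x
  have hcη : ∀ u, chartCov η x z (chartD x x u) = η x u := chartCov_self η x
  have hav := fun u => congrArg (fun T => T u) hr
  have hv := hav v
  have hw := hav w
  unfold nablaTwo
  rw [extD_oneForm hα, extD_oneForm hη, hct, hkt.self_of_nhds, hfs.self_of_nhds]
  simp only [ContinuousLinearMap.smulRight_apply, _root_.add_apply, _root_.smul_apply,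
    smul_eq_mul, Function.comp_apply, hψz, hdk, hdf, hca, hcη,
    smul_smul, ← sub_smul] at hvw hwv hv hw ⊢
  congr 1
  linear_combination hwv - hvw + hsymm + α x w * hv - α x v * hw

end ConnLineBundle

theorem extD_oneForm_add {α β : ∀ x : X, TangentSpace 𝓘(ℂ, V) x →L[ℂ] ℂ} {x : X}
    (hα : HolFormAt (oneForm α) x) (hβ : HolFormAt (oneForm β) x)
    (hαβ : HolFormAt (oneForm fun y => α y + β y) x) (v w : TangentSpace 𝓘(ℂ, V) x) :
    extD (oneForm fun y => α y + β y) x ![v, w] =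
      extD (oneForm α) x ![v, w] + extD (oneForm β) x ![v, w] := by
  have h : chartCov (fun y => α y + β y) x = fun z => chartCov α x z + chartCov β x z := by
    ext z u; rfl
  rw [extD_oneForm hα, extD_oneForm hβ, extD_oneForm hαβ, h,
    fderiv_fun_add (holFormAt_chartCov hα) (holFormAt_chartCov hβ)]
  simp only [_root_.add_apply]
  ring

theorem extD_oneForm_neg {α : ∀ x : X, TangentSpace 𝓘(ℂ, V) x →L[ℂ] ℂ} {x : X}
    (hα : HolFormAt (oneForm α) x) (hα' : HolFormAt (oneForm fun y => - α y) x)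
    (v w : TangentSpace 𝓘(ℂ, V) x) :
    extD (oneForm fun y => - α y) x ![v, w] = - extD (oneForm α) x ![v, w] := by
  have h : chartCov (fun y => - α y) x = fun z => - chartCov α x z := by
    ext z u; rfl
  rw [extD_oneForm hα, extD_oneForm hα', h, fderiv_fun_neg]
  simp only [_root_.neg_apply]
  ring

namespace ConnLineBundle

open HolLineBundle

variable {A B C D : ConnLineBundle V X}

/-- The connection is integrable: `∇² (∇ s) = 0` for all local holomorphic sections `s`, where
`∇ s` is written locally as `η ⊗ t`. -/
def Integrable (A : ConnLineBundle V X) : Prop :=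
  ∀ (x : X) (s t : ∀ x, A.fiber x) (η : ∀ x : X, TangentSpace 𝓘(ℂ, V) x →L[ℂ] ℂ),
    A.HolAt s x → A.HolAt t x → HolFormAt (oneForm η) x →
    (∀ᶠ y in 𝓝 x, A.conn s y = (η y).smulRight (t y)) →
    ∀ v w, A.nablaTwo η t x v w = 0

section Rep

variable {U U' : X → Set X} {g g' : X → X → X → ℂ}
    {α α' : X → ∀ x : X, TangentSpace 𝓘(ℂ, V) x →L[ℂ] ℂ}

theorem Rep.hol (hA : A.Rep U g α) {i x : X} (hx : x ∈ U i) : HolFormAt (oneForm (α i)) x := by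
  obtain ⟨e, he⟩ := hA.ex
  rw [← hom_iff A.toHolLineBundle (he i x hx).1 (he i x hx).2.1]
  refine (hol_conn_at (he i x hx).1).congr_of_eventuallyEq ?_
  filter_upwards [(hA.isOpen i).mem_nhds hx] with y hy
  rw [(he i y hy).2.2.1]

theorem Rep.integrable_iff (hA : A.Rep U g α) : A.Integrable ↔
    ∀ i, ∀ x ∈ U i, ∀ v w, extD (oneForm (α i)) x ![v, w] = 0 := by
  obtain ⟨e, he⟩ := hA.ex
  have hc : ∀ i x, x ∈ U i → ∀ᶠ y in 𝓝 x, A.conn (e i) y = (α i y).smulRight (e i y) := by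
    intro i x hx
    filter_upwards [(hA.isOpen i).mem_nhds hx] with y hy using (he i y hy).2.2.1
  constructor
  · intro h i x hx v w
    obtain ⟨h1, h2, -, -⟩ := he i x hx
    have h3 := h x (e i) (e i) (α i) h1 h1 (hA.hol hx) (hc i x hx) v w
    rw [nablaTwo_eq h1 h2 (hA.hol hx) (hc i x hx) h1 h1 (hA.hol hx) (hc i x hx)] at h3
    exact (smul_eq_zero.1 h3).resolve_right h2
  · intro h x s t η hs ht hη hst v w
    obtain ⟨h1, h2, -, -⟩ := he x x (hA.mem x)
    rw [nablaTwo_eq h1 h2 (hA.hol (hA.mem x)) (hc x x (hA.mem x)) hs ht hη hst,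
      h x x (hA.mem x), zero_smul]

end Rep

theorem Integrable.tensor (hA : A.Integrable) (hB : B.Integrable) : (A.tensor B).Integrable := by
  have hAB := A.rep_self.tensor B.rep_self
  refine hAB.integrable_iff.2 fun i x hx v w => ?_
  rw [extD_oneForm_add (A.rep_self.hol hx.1) (B.rep_self.hol hx.2) (hAB.hol hx),
    A.rep_self.integrable_iff.1 hA i x hx.1, B.rep_self.integrable_iff.1 hB i x hx.2, add_zero]

theorem Integrable.dual (hA : A.Integrable) : A.dual.Integrable := by
  refine A.rep_self.dual.integrable_iff.2 fun i x hx v w => ?_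
  rw [extD_oneForm_neg (A.rep_self.hol hx) (A.rep_self.dual.hol hx),
    A.rep_self.integrable_iff.1 hA i x hx, neg_zero]

theorem integrable_trivial : (trivial V X).Integrable := by
  refine rep_trivial.integrable_iff.2 fun i x hx v w => ?_
  have h : chartCov (fun y : X => (0 : TangentSpace 𝓘(ℂ, V) y →L[ℂ] ℂ)) x = fun _ => 0 := by
    ext z u; rfl
  rw [extD_oneForm (rep_trivial.hol (i := i) hx), h]
  simp

/-! ### Isomorphism classes -/

variable (V X) in
/-- Two line bundles with connection are equivalent if they are isomorphic. -/
def isoSetoid : Setoid (ConnLineBundle V X) where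
  r A B := Nonempty (Iso A B)
  iseqv :=
    { refl := fun A => A.rep_self.iso A.rep_self (fun _ _ _ _ _ _ _ => rfl) (fun _ _ _ _ => rfl)
      symm := fun {A _} ⟨φ⟩ => (A.rep_self.map φ).iso A.rep_self
        (fun _ _ _ _ _ _ _ => rfl) (fun _ _ _ _ => rfl)
      trans := fun {A _ _} ⟨φ⟩ ⟨ψ⟩ => A.rep_self.iso ((A.rep_self.map φ).map ψ)
        (fun _ _ _ _ _ _ _ => rfl) (fun _ _ _ _ => rfl) }

theorem iso_tensor (φ : Iso A B) (ψ : Iso C D) : Nonempty (Iso (A.tensor C) (B.tensor D)) :=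
  (A.rep_self.tensor C.rep_self).iso ((A.rep_self.map φ).tensor (C.rep_self.map ψ))
    (fun _ _ _ _ _ _ _ => rfl) (fun _ _ _ _ => rfl)

theorem iso_dual (φ : Iso A B) : Nonempty (Iso A.dual B.dual) :=
  A.rep_self.dual.iso (A.rep_self.map φ).dual (fun _ _ _ _ _ _ _ => rfl) (fun _ _ _ _ => rfl)

theorem iso_assoc : Nonempty (Iso ((A.tensor B).tensor C) (A.tensor (B.tensor C))) :=
  ((A.rep_self.tensor B.rep_self).tensor C.rep_self).iso
    (A.rep_self.tensor (B.rep_self.tensor C.rep_self))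
    (fun _ _ _ _ _ _ _ => mul_assoc _ _ _) (fun _ _ _ _ => add_assoc _ _ _)

theorem iso_comm : Nonempty (Iso (A.tensor B) (B.tensor A)) :=
  (A.rep_self.tensor B.rep_self).iso (B.rep_self.tensor A.rep_self)
    (fun _ _ _ _ _ _ _ => mul_comm _ _) (fun _ _ _ _ => add_comm _ _)

theorem iso_trivial : Nonempty (Iso ((trivial V X).tensor A) A) :=
  (rep_trivial.tensor A.rep_self).iso A.rep_self
    (fun _ _ _ _ _ _ _ => one_mul _) (fun _ _ _ _ => zero_add _)

theorem iso_dual_tensor : Nonempty (Iso (A.dual.tensor A) (trivial V X)) := by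
  refine (A.rep_self.dual.tensor A.rep_self).iso rep_trivial
    (fun i j x hi _ hj _ => inv_mul_cancel₀ fun h => ?_) (fun _ _ _ _ => neg_add_cancel _)
  have := trans_smul (L := A.toHolLineBundle) (i := i) hj.2
  rw [h, zero_smul] at this
  exact frame_ne_zero hi.2 this.symm

end ConnLineBundle

open ConnLineBundle

variable (V X) in
/-- The group of isomorphism classes of holomorphic line bundles with holomorphic connection. -/
def PicC : Type (max u v 1) := Quotient (isoSetoid V X)

/-- The class of a line bundle with connection. -/
def PicC.mk (A : ConnLineBundle V X) : PicC V X := Quotient.mk (isoSetoid V X) A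

theorem PicC.mk_eq_mk {A B : ConnLineBundle V X} : PicC.mk A = PicC.mk B ↔ Nonempty (Iso A B) :=
  Quotient.eq (r := isoSetoid V X)

/-- The group law is the tensor product of line bundles with connection. -/
instance : Add (PicC V X) :=
  ⟨Quotient.map₂ ConnLineBundle.tensor fun _ _ ⟨φ⟩ _ _ ⟨ψ⟩ => iso_tensor φ ψ⟩

/-- The neutral element is the class of `(𝒪, d)`. -/
instance : Zero (PicC V X) := ⟨PicC.mk (trivial V X)⟩

/-- The inverse is the dual line bundle with the dual connection. -/
instance : Neg (PicC V X) := ⟨Quotient.map ConnLineBundle.dual fun _ _ ⟨φ⟩ => iso_dual φ⟩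

theorem PicC.mk_add_mk (A B : ConnLineBundle V X) :
    PicC.mk A + PicC.mk B = PicC.mk (A.tensor B) := rfl

instance : AddCommGroup (PicC V X) where
  add_assoc := by rintro ⟨A⟩ ⟨B⟩ ⟨C⟩; exact PicC.mk_eq_mk.2 iso_assoc
  zero_add := by rintro ⟨A⟩; exact PicC.mk_eq_mk.2 iso_trivial
  add_zero := by
    rintro ⟨A⟩
    exact (PicC.mk_eq_mk.2 iso_comm).trans (PicC.mk_eq_mk.2 iso_trivial)
  add_comm := by rintro ⟨A⟩ ⟨B⟩; exact PicC.mk_eq_mk.2 iso_comm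
  neg_add_cancel := by rintro ⟨A⟩; exact PicC.mk_eq_mk.2 iso_dual_tensor
  nsmul := nsmulRec
  zsmul := zsmulRec

variable (V X) in
/-- Holomorphic line bundles with integrable connection. -/
abbrev IntConnLineBundle : Type (max u v 1) := {A : ConnLineBundle V X // A.Integrable}

variable (V X) in
/-- Two line bundles with integrable connection are equivalent if they are isomorphic. -/
def intIsoSetoid : Setoid (IntConnLineBundle V X) where
  r A B := Nonempty (Iso A.1 B.1)
  iseqv :=
    { refl := fun A => (isoSetoid V X).refl A.1
      symm := fun h => (isoSetoid V X).symm h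
      trans := fun h h' => (isoSetoid V X).trans h h' }

variable (V X) in
/-- The group of isomorphism classes of holomorphic line bundles with integrable holomorphic
connection. -/
def PicCI : Type (max u v 1) := Quotient (intIsoSetoid V X)

namespace PicCI

/-- The class of a line bundle with integrable connection. -/
def mk (A : IntConnLineBundle V X) : PicCI V X := Quotient.mk (intIsoSetoid V X) A

theorem mk_eq_mk {A B : IntConnLineBundle V X} : mk A = mk B ↔ Nonempty (Iso A.1 B.1) :=
  Quotient.eq (r := intIsoSetoid V X)

/-- The group law is the tensor product of line bundles with connection. -/
instance : Add (PicCI V X) :=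
  ⟨Quotient.map₂ (fun A B => ⟨A.1.tensor B.1, A.2.tensor B.2⟩)
    fun _ _ ⟨φ⟩ _ _ ⟨ψ⟩ => iso_tensor φ ψ⟩

/-- The neutral element is the class of `(𝒪, d)`. -/
instance : Zero (PicCI V X) := ⟨mk ⟨trivial V X, integrable_trivial⟩⟩

/-- The inverse is the dual line bundle with the dual connection. -/
instance : Neg (PicCI V X) :=
  ⟨Quotient.map (fun A => ⟨A.1.dual, A.2.dual⟩) fun _ _ ⟨φ⟩ => iso_dual φ⟩

instance : AddCommGroup (PicCI V X) where
  add_assoc := by rintro ⟨A⟩ ⟨B⟩ ⟨C⟩; exact mk_eq_mk.2 iso_assoc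
  zero_add := by rintro ⟨A⟩; exact mk_eq_mk.2 iso_trivial
  add_zero := by
    rintro ⟨A⟩
    exact mk_eq_mk.2 ((isoSetoid V X).trans iso_comm iso_trivial)
  add_comm := by rintro ⟨A⟩ ⟨B⟩; exact mk_eq_mk.2 iso_comm
  neg_add_cancel := by rintro ⟨A⟩; exact mk_eq_mk.2 iso_dual_tensor
  nsmul := nsmulRec
  zsmul := zsmulRec

variable (V X) in
/-- The map sending the class of a line bundle with integrable connection to the class of the
same line bundle with the same connection. -/
def toPicC : PicCI V X →+ PicC V X :=
  AddMonoidHom.mk' (Quotient.lift (fun A => PicC.mk A.1) fun _ _ h => PicC.mk_eq_mk.2 h)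
    (by rintro ⟨A⟩ ⟨B⟩; rfl)

end PicCI

end HolPic

end

/-!
In a nowhere vanishing local frame `e` the connection is `∇ e = α ⊗ e`, and the Leibniz rule gives
`∇² (∇ s) = dα ⊗ s` for every section `s`. So the curvature is `dα` near each point, whatever the
frame. It is holomorphic because `d` commutes with changes of charts, and it is additive because the
connection form of `e₁ ⊗ e₂` is `α₁ + α₂`. A connection is integrable exactly when its curvature
vanishes, which is exactness in the middle.
-/

noncomputable section

namespace HolPic

open Set
open scoped Topology

section Alternating

variable {𝕜 E F : Type*} [NontriviallyNormedField 𝕜] [NormedAddCommGroup E] [NormedSpace 𝕜 E]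
  [NormedAddCommGroup F] [NormedSpace 𝕜 F]

theorem contDiffAt_extDeriv {p : ℕ} {m n : WithTop ℕ∞} {θ : E → E [⋀^Fin p]→L[𝕜] F} {z : E}
    (h : ContDiffAt 𝕜 n θ z) (hmn : m + 1 ≤ n) : ContDiffAt 𝕜 m (extDeriv θ) z := by
  have hfderiv : ContDiffAt 𝕜 m (fderiv 𝕜 θ) z := h.fderiv_right hmn
  exact hfderiv.continuousLinearMap_comp
    (ContinuousAlternatingMap.alternatizeUncurryFinCLM (n := p) 𝕜 E F)

end Alternating

theorem continuousAlternatingMap_ext_fin_two {R M N : Type*} [Semiring R] [AddCommMonoid M]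
    [Module R M] [TopologicalSpace M] [AddCommMonoid N] [Module R N] [TopologicalSpace N]
    {f g : M [⋀^Fin 2]→L[R] N} (h : ∀ v w, f ![v, w] = g ![v, w]) : f = g :=
  ContinuousAlternatingMap.ext ((FinVec.forall_iff _).1 h)

universe u v

variable {V : Type u} [NormedAddCommGroup V] [NormedSpace ℂ V]
  {X : Type v} [TopologicalSpace X] [ChartedSpace V X] {p : ℕ} {η θ : Form V X p} {x y : X} {z : V}

theorem HolFormAt.congr (h : HolFormAt η x) (hθ : ∀ᶠ y in 𝓝 x, θ y = η y) : HolFormAt θ x := by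
  refine ContDiffAt.congr_of_eventuallyEq h ?_
  filter_upwards [(continuousAt_extChartAt_symm x).eventually
    (p := fun y => θ y = η y) (by rwa [extChartAt_to_inv])] with z hz
  rw [chartForm, chartForm, hz]

section C1

variable [IsManifold 𝓘(ℂ, V) 1 X]

theorem mdifferentiableAt_extChartAt_symm (hz : z ∈ (extChartAt 𝓘(ℂ, V) x).target) :
    MDifferentiableAt 𝓘(ℂ, V) 𝓘(ℂ, V) (extChartAt 𝓘(ℂ, V) x).symm z := by
  have h := mdifferentiableWithinAt_extChartAt_symm (I := 𝓘(ℂ, V)) hz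
  rwa [modelWithCornersSelf_coe, range_id, mdifferentiableWithinAt_univ] at h

theorem chartD_comp_chartSymmD (hz : z ∈ (extChartAt 𝓘(ℂ, V) x).target)
    (hy : (extChartAt 𝓘(ℂ, V) x).symm z ∈ (extChartAt 𝓘(ℂ, V) y).source) :
    (chartD y ((extChartAt 𝓘(ℂ, V) x).symm z)).comp (chartSymmD x z) =
      fderiv ℂ (extChartAt 𝓘(ℂ, V) y ∘ (extChartAt 𝓘(ℂ, V) x).symm) z := by
  rw [← mfderiv_eq_fderiv]
  exact (mfderiv_comp z (mdifferentiableAt_extChartAt (by rwa [← extChartAt_source 𝓘(ℂ, V)]))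
    (mdifferentiableAt_extChartAt_symm hz)).symm

theorem chartForm_comp_chartD (η : Form V X p) (hy : y ∈ (extChartAt 𝓘(ℂ, V) x).source) :
    (chartForm η x (extChartAt 𝓘(ℂ, V) x y)).compContinuousLinearMap (chartD x y) = η y := by
  set φ := extChartAt 𝓘(ℂ, V) x
  have hpoint : (η (φ.symm (φ y)) : V [⋀^Fin p]→L[ℂ] ℂ) = η y := by
    rw [φ.left_inv hy]
  have hinv : ((chartSymmD x (φ y) : V →L[ℂ] V).comp (chartD x y : V →L[ℂ] V)) =
      ContinuousLinearMap.id ℂ V := by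
    have h := mfderivWithin_extChartAt_symm_comp_mfderiv_extChartAt' (I := 𝓘(ℂ, V)) hy
    rwa [modelWithCornersSelf_coe, range_id, mfderivWithin_univ] at h
  change (η (φ.symm (φ y)) : V [⋀^Fin p]→L[ℂ] ℂ).compContinuousLinearMap
    ((chartSymmD x (φ y) : V →L[ℂ] V).comp (chartD x y : V →L[ℂ] V)) = η y
  rw [hpoint, hinv]
  rfl

theorem chartForm_eq_pullback (η : Form V X p) (hz : z ∈ (extChartAt 𝓘(ℂ, V) x).target)
    (hy : (extChartAt 𝓘(ℂ, V) x).symm z ∈ (extChartAt 𝓘(ℂ, V) y).source) :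
    chartForm η x z =
      (chartForm η y (extChartAt 𝓘(ℂ, V) y ((extChartAt 𝓘(ℂ, V) x).symm z))).compContinuousLinearMap
        (fderiv ℂ (extChartAt 𝓘(ℂ, V) y ∘ (extChartAt 𝓘(ℂ, V) x).symm) z) := by
  rw [← chartD_comp_chartSymmD hz hy, chartForm, ← chartForm_comp_chartD η hy]
  rfl

end C1

section C2

variable [IsManifold 𝓘(ℂ, V) 2 X]

theorem chartForm_extD (hz : z ∈ (extChartAt 𝓘(ℂ, V) x).target)
    (hη : DifferentiableAt ℂ (chartForm η ((extChartAt 𝓘(ℂ, V) x).symm z))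
      (extChartAt 𝓘(ℂ, V) ((extChartAt 𝓘(ℂ, V) x).symm z) ((extChartAt 𝓘(ℂ, V) x).symm z))) :
    chartForm (extD η) x z = extDeriv (chartForm η x) z := by
  set ψ := extChartAt 𝓘(ℂ, V) x
  set φ := extChartAt 𝓘(ℂ, V) (ψ.symm z)
  have hy : ψ.symm z ∈ φ.source := mem_extChartAt_source _
  have htrans : ContDiffAt ℂ 2 (φ ∘ ψ.symm) z := by
    have h := contDiffWithinAt_ext_coord_change (I := 𝓘(ℂ, V)) (n := 2) (ψ.symm z) x ⟨hz, hy⟩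
    rwa [modelWithCornersSelf_coe, range_id, contDiffWithinAt_univ] at h
  have hpullback : chartForm η x =ᶠ[𝓝 z] fun z' =>
      (chartForm η (ψ.symm z) ((φ ∘ ψ.symm) z')).compContinuousLinearMap
        (fderiv ℂ (φ ∘ ψ.symm) z') := by
    filter_upwards [(isOpen_extChartAt_target x).mem_nhds hz,
      (mdifferentiableAt_extChartAt_symm hz).continuousAt.preimage_mem_nhds
        ((isOpen_extChartAt_source _).mem_nhds hy)]
      with z' hz' hy' using chartForm_eq_pullback η hz' hy'
  rw [hpullback.extDeriv_eq, extDeriv_pullback (f := φ ∘ ψ.symm) hη htrans (by simp),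
    ← chartD_comp_chartSymmD hz hy]
  rfl

theorem HolFormAt.extD (h : ∀ᶠ y in 𝓝 x, HolFormAt η y) : HolFormAt (extD η) x := by
  refine (contDiffAt_extDeriv h.self_of_nhds (by simp)).congr_of_eventuallyEq ?_
  filter_upwards [(continuousAt_extChartAt_symm x).eventually
      (p := HolFormAt η) (by rwa [extChartAt_to_inv]), extChartAt_target_mem_nhds x]
    with z hη hz using chartForm_extD hz (hη.differentiableAt (by simp))

end C2

variable [IsManifold 𝓘(ℂ, V) ω X]

namespace ConnLineBundle

open HolLineBundle

variable {A B : ConnLineBundle V X} {R : Form V X 2}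

/-- The curvature form of a line bundle with connection. Its value at `x` is `dα`, where `α` is the
connection form of the frame given by the preferred trivialization at `x`. -/
def curvature (A : ConnLineBundle V X) : Form V X 2 := fun x => extD (oneForm (A.connForm x)) x

theorem isCurvature_curvature (A : ConnLineBundle V X) : A.IsCurvature A.curvature := by
  intro x s t η hs ht hη hst v w
  have hx := A.mem_dom x
  have hframe : ∀ᶠ y in 𝓝 x, A.conn (A.frame x) y = (A.connForm x y).smulRight (A.frame x y) := by
    filter_upwards [A.dom_mem_nhds hx] with y hy using conn_frame hy
  exact nablaTwo_eq (holAt_frame hx) (frame_ne_zero hx) (hol_connForm hx) hframe hs ht hη hst v w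

theorem IsCurvature.apply_eq_extD (hR : A.IsCurvature R) {e : ∀ x, A.fiber x}
    {α : ∀ x : X, TangentSpace 𝓘(ℂ, V) x →L[ℂ] ℂ} {x : X} (he : A.HolAt e x) (he0 : e x ≠ 0)
    (hα : HolFormAt (oneForm α) x) (hconn : ∀ᶠ y in 𝓝 x, A.conn e y = (α y).smulRight (e y)) :
    R x = extD (oneForm α) x :=
  continuousAlternatingMap_ext_fin_two fun v w => smul_left_injective ℂ he0 <|
    (hR x e e α he he hα hconn v w).symm.trans
      (nablaTwo_eq he he0 hα hconn he he hα hconn v w)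

theorem IsCurvature.apply_eq_extD_of_rep (hR : A.IsCurvature R) {U : X → Set X} {g : X → X → X → ℂ}
    {α : X → ∀ x : X, TangentSpace 𝓘(ℂ, V) x →L[ℂ] ℂ} (hA : A.Rep U g α) {i x : X}
    (hx : x ∈ U i) : R x = extD (oneForm (α i)) x := by
  obtain ⟨e, he⟩ := hA.ex
  refine hR.apply_eq_extD (he i x hx).1 (he i x hx).2.1 (hA.hol hx) ?_
  filter_upwards [(hA.isOpen i).mem_nhds hx] with y hy using (he i y hy).2.2.1

theorem isCurvature_iff_curvature_eq : A.IsCurvature R ↔ A.curvature = R where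
  mp hR := funext fun x => (hR.apply_eq_extD_of_rep A.rep_self (A.mem_dom x)).symm
  mpr hR := hR ▸ A.isCurvature_curvature

theorem holFormAt_curvature (A : ConnLineBundle V X) (x : X) : HolFormAt A.curvature x := by
  have hdom := A.dom_mem_nhds (A.mem_dom x)
  refine HolFormAt.congr (η := extD (oneForm (A.connForm x))) (HolFormAt.extD ?_) ?_
  · filter_upwards [hdom] with y hy using hol_connForm hy
  · filter_upwards [hdom] with y hy using A.isCurvature_curvature.apply_eq_extD_of_rep A.rep_self hy

theorem curvature_congr (φ : Iso A B) : A.curvature = B.curvature :=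
  funext fun x =>
    (B.isCurvature_curvature.apply_eq_extD_of_rep (A.rep_self.map φ) (A.mem_dom x)).symm

theorem curvature_tensor (A B : ConnLineBundle V X) :
    (A.tensor B).curvature = A.curvature + B.curvature := by
  funext x
  have hrep := A.rep_self.tensor B.rep_self
  have hx : x ∈ A.dom x ∩ B.dom x := ⟨A.mem_dom x, B.mem_dom x⟩
  rw [(A.tensor B).isCurvature_curvature.apply_eq_extD_of_rep hrep hx]
  exact continuousAlternatingMap_ext_fin_two
    (extD_oneForm_add (hol_connForm hx.1) (hol_connForm hx.2) (hrep.hol hx))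

theorem integrable_iff_curvature_eq_zero : A.Integrable ↔ A.curvature = 0 := by
  rw [← isCurvature_iff_curvature_eq]
  have hzero (x : X) (v w : TangentSpace 𝓘(ℂ, V) x) (s : A.fiber x) :
      (0 : Form V X 2) x ![v, w] • s = 0 := zero_smul ℂ s
  simp only [Integrable, IsCurvature, hzero]

end ConnLineBundle

open ConnLineBundle

/-- The homomorphism that sends the class of a line bundle with connection to its curvature. -/
def PicC.curvature : PicC V X →+ HolForm V X 2 :=
  AddMonoidHom.mk'
    (Quotient.lift (fun A => ⟨A.curvature, A.holFormAt_curvature⟩)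
      fun _ _ ⟨φ⟩ => Subtype.ext (curvature_congr φ))
    (by rintro ⟨A⟩ ⟨B⟩; exact Subtype.ext (curvature_tensor A B))

theorem PicC.curvature_mk_eq_iff {A : ConnLineBundle V X} {R : HolForm V X 2} :
    PicC.curvature (PicC.mk A) = R ↔ A.IsCurvature R :=
  Subtype.ext_iff.trans isCurvature_iff_curvature_eq.symm

theorem PicC.curvature_mk_eq_zero_iff {A : ConnLineBundle V X} :
    PicC.curvature (PicC.mk A) = 0 ↔ A.Integrable :=
  Subtype.ext_iff.trans integrable_iff_curvature_eq_zero.symm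

theorem PicCI.toPicC_injective : Function.Injective (PicCI.toPicC V X) := by
  rintro ⟨A⟩ ⟨B⟩ h
  exact PicCI.mk_eq_mk.2 (PicC.mk_eq_mk.1 h)

theorem PicCI.exact_toPicC_curvature :
    Function.Exact (PicCI.toPicC V X) (PicC.curvature (V := V) (X := X)) := by
  rintro ⟨A⟩
  constructor
  · exact fun hA => ⟨PicCI.mk ⟨A, PicC.curvature_mk_eq_zero_iff.1 hA⟩, rfl⟩
  · rintro ⟨⟨B⟩, hB⟩
    rw [← hB]
    exact PicC.curvature_mk_eq_zero_iff.2 B.2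

end HolPic

end

theorem mainTheorem10_general (V : Type*) [NormedAddCommGroup V] [NormedSpace ℂ V]
    (X : Type*) [TopologicalSpace X] [ChartedSpace V X] [IsManifold 𝓘(ℂ, V) ω X] :
    ∃ κ : HolPic.PicC V X →+ HolPic.HolForm V X 2,
      (∀ (A : HolPic.ConnLineBundle V X) (R : HolPic.HolForm V X 2),
        κ (HolPic.PicC.mk A) = R ↔ A.IsCurvature R) ∧
      Function.Injective (HolPic.PicCI.toPicC V X) ∧
      Function.Exact (HolPic.PicCI.toPicC V X) κ :=
  ⟨HolPic.PicC.curvature, fun _ _ => HolPic.PicC.curvature_mk_eq_iff,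
    HolPic.PicCI.toPicC_injective, HolPic.PicCI.exact_toPicC_curvature⟩

theorem mainTheorem10 (V : Type*) [NormedAddCommGroup V] [NormedSpace ℂ V]
    [FiniteDimensional ℂ V] (X : Type*) [TopologicalSpace X] [ChartedSpace V X]
    [IsManifold 𝓘(ℂ, V) ω X] :
    ∃ κ : HolPic.PicC V X →+ HolPic.HolForm V X 2,
      (∀ (A : HolPic.ConnLineBundle V X) (R : HolPic.HolForm V X 2),
        κ (HolPic.PicC.mk A) = R ↔ A.IsCurvature R) ∧
      Function.Injective (HolPic.PicCI.toPicC V X) ∧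
      Function.Exact (HolPic.PicCI.toPicC V X) κ :=
  mainTheorem10_general V X
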